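/- Let $(\mathcal A;\mathcal E)$ be a Frobenius category, that is, an (additive) exact category in the sense of Quillen with enough projective and enough injective objects in which the projective and the injective objects coincide. Let $\omega$ be the full subcategory of projective objects and $\mathcal A/\omega$ the stable category, with its usual shift $[1]$ and distinguished triangles. Write $\underline{M}$ for the image in $\mathcal A/\omega$ of an object $M$ of $\mathcal A$, and $\underline{\mathcal X}$ for the image of a full subcategory $\mathcal X$. For an ideal $\mathcal I$ of $\mathcal A$ put $\mathrm{Ob}(\mathcal I)=\{X\in\mathcal A : 1_X\in\mathcal I\}$; $\mathcal I$ is an object ideal if it consists exactly of the morphisms that factor through an object of $\mathrm{Ob}(\mathcal I)$. A pair $(\mathcal I,\mathcal J)$ of ideals is an ideal cotorsion pair if $\mathcal I={}^{\perp}\mathcal J$ and $\mathcal J=\mathcal I^{\perp}$, where ${}^{\perp}\mathcal J=\{a : \mathrm{Ext}(a,j)=0 \text{ for all } j\in\mathcal J\}$ and $\mathcal I^{\perp}=\{b : \mathrm{Ext}(i,b)=0 \text{ for all } i\in\mathcal I\}$. It is complete if every object has a special $\mathcal I$-precover (an $\mathcal I$-precover $f\colon A\to X$ that is a deflation and whose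 conflation $L\rightarrowtail A\twoheadrightarrow X$ is the pushout of a conflation $K\rightarrowtail A'\twoheadrightarrow X$ along some $g\colon K\to L$ in $\mathcal I^{\perp}$) and, dually, a special $\mathcal J$-preenvelope. A pair $(\mathcal X,\mathcal Y)$ of full subcategories is a complete cotorsion pair if $\mathcal X=\{X : \mathrm{Ext}^1(X,Y)=0\ \forall\, Y\in\mathcal Y\}$, $\mathcal Y=\{Y : \mathrm{Ext}^1(X,Y)=0\ \forall\, X\in\mathcal X\}$, and for every object $M$ there are conflations $Y_M\rightarrowtail X_M\twoheadrightarrow M$ and $M\rightarrowtail Y^M\twoheadrightarrow X^M$ with $X_M,X^M\in\mathcal X$ and $Y_M,Y^M\in\mathcal Y$. Finally, $\mathcal X\oplus\mathcal Y$ is the class of direct sums $X\oplus Y$ with $X\in\mathcal X$, $Y\in\mathcal Y$, and $\mathrm{smd}(\mathcal Z)$ is the class of objects isomorphic to a direct summand of an object of $\mathcal Z$. Let $(\mathcal I,\mathcal J)$ be a complete ideal cotorsion pair in $\mathcal A$ such that both $\mathcal I$ and $\mathcal J$ are object ideals, and set $\mathcal X=\mathrm{Ob}(\mathcal I)$, $\mathcal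 Y=\mathrm{Ob}(\mathcal J)$. Then the following are equivalent: 1. $(\mathcal X,\mathcal Y)$ is a complete cotorsion pair in $\mathcal A$. 2. For every object $\underline{M}$ in $\mathrm{smd}(\underline{\mathcal X}\oplus\underline{\mathcal Y})$ there is a distinguished triangle $\underline{M}\to\underline{Y}\to\underline{X}\to\underline{M}[1]$ in $\mathcal A/\omega$ with $Y\in\mathcal Y$ and $X\in\mathcal X$. 3. For every object $M$ in $\mathrm{smd}(\mathcal X\oplus\mathcal Y)$ there is a conflation $M\rightarrowtail Y\twoheadrightarrow X$ in $\mathcal A$ with $Y\in\mathcal Y$ and $X\in\mathcal X$. If in addition $\mathcal A/\omega$ is Krull–Schmidt (every object is a finite direct sum of objects with local endomorphism rings), then all of (1), (2), (3) hold. -/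

import Mathlib

set_option linter.unusedSectionVars false

open CategoryTheory CategoryTheory.Limits

universe v u

namespace IdealApprox

/-! ### Sums of subcategories, direct summands, Krull-Schmidt categories -/

section Additive

variable {D : Type u} [Category.{v} D] [Preadditive D]

/-- `𝒳 ⊕ 𝒴`: the objects that are a biproduct `X ⊕ Y` with `X ∈ 𝒳` and `Y ∈ 𝒴`. -/
def sumProp (P Q : ObjectProperty D) : ObjectProperty D := fun Z =>
  ∃ (X Y : D) (b : BinaryBicone X Y), P X ∧ Q Y ∧ Nonempty b.IsBilimit ∧ Nonempty (Z ≅ b.pt)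

/-- `smd(𝒳)`: the objects isomorphic to a direct summand of an object of `𝒳`; here
`M` is a direct summand of `Z` when `Z` is a biproduct of `M` and some complement `N`. -/
def smd (P : ObjectProperty D) : ObjectProperty D := fun M =>
  ∃ (Z N : D) (b : BinaryBicone M N), P Z ∧ Nonempty b.IsBilimit ∧ Nonempty (Z ≅ b.pt)

variable (D) in
/-- Every object is a finite (possibly empty) direct sum of objects with local endomorphism
rings. -/
def IsKrullSchmidt : Prop :=
  ∀ X : D, ∃ (n : ℕ) (F : Fin n → D) (b : Bicone F),
    Nonempty b.IsBilimit ∧ Nonempty (X ≅ b.pt) ∧ ∀ j, IsLocalRing (End (F j))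

end Additive

/-! ### Ideals of morphisms -/

section Ideals

variable (A : Type u) [Category.{v} A] [Preadditive A]

/-- An ideal of a preadditive category: an additive subbifunctor of `Hom`. -/
structure MorIdeal where
  /-- the subgroup `ℐ(X, Y)` of `Hom(X, Y)` -/
  hom : ∀ X Y : A, AddSubgroup (X ⟶ Y)
  comp_mem : ∀ {W X Y Z : A} (h : W ⟶ X) (g : X ⟶ Y) (f : Y ⟶ Z),
    g ∈ hom X Y → h ≫ g ≫ f ∈ hom W Z

variable {A}

/-- The class of all morphisms that belong to an ideal. -/
def MorIdeal.toProp (I : MorIdeal A) : MorphismProperty A := fun X Y f => f ∈ I.hom X Y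

/-- `Ob(ℐ)`: the objects whose identity belongs to `ℐ`. -/
def MorIdeal.Ob (I : MorIdeal A) : ObjectProperty A := fun X => I.toProp (𝟙 X)

/-- `ℐ(𝒳)`: the morphisms that factor through an object of `𝒳`. -/
def factorsThrough (P : ObjectProperty A) : MorphismProperty A := fun X Y f =>
  ∃ (Z : A) (s : X ⟶ Z) (t : Z ⟶ Y), P Z ∧ s ≫ t = f

/-- An object ideal: `ℐ = ℐ(Ob(ℐ))`. -/
def MorIdeal.IsObjectIdeal (I : MorIdeal A) : Prop := I.toProp = factorsThrough I.Ob

/-- `f` is an `M`-precover of `X`: `f ∈ M`, and every morphism of `M` ending at `X` factors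
through `f`. -/
def IsPrecover (M : MorphismProperty A) {B X : A} (f : B ⟶ X) : Prop :=
  M f ∧ ∀ ⦃B' : A⦄ (f' : B' ⟶ X), M f' → ∃ h : B' ⟶ B, h ≫ f = f'

/-- `f` is an `M`-preenvelope of `X`: `f ∈ M`, and every morphism of `M` starting at `X` factors
through `f`. -/
def IsPreenvelope (M : MorphismProperty A) {X B : A} (f : X ⟶ B) : Prop :=
  M f ∧ ∀ ⦃B' : A⦄ (f' : X ⟶ B'), M f' → ∃ h : B ⟶ B', f ≫ h = f'

end Ideals

/-! ### Exact categories -/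

section Exact

variable (A : Type u) [Category.{v} A] [Preadditive A] [HasFiniteBiproducts A]

/-- A Quillen exact structure on an additive category: a class of kernel-cokernel pairs, closed
under isomorphisms, whose inflations and deflations contain the identities, are closed under
composition, and are stable under pushout, respectively pullback, along arbitrary morphisms. -/
structure ExactStructure where
  /-- the class of conflations -/
  conflation : ObjectProperty (ShortComplex A)
  of_iso : ∀ {S S' : ShortComplex A}, (S ≅ S') → conflation S → conflation S'
  isKernel : ∀ {S : ShortComplex A}, conflation S →
    Nonempty (IsLimit (KernelFork.ofι S.f S.zero))
  isCokernel : ∀ {S : ShortComplex A}, conflation S →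
    Nonempty (IsColimit (CokernelCofork.ofπ S.g S.zero))
  /-- identities are inflations -/
  id_inflation : ∀ X : A, ∃ (Z : A) (g : X ⟶ Z) (w : 𝟙 X ≫ g = 0),
    conflation (ShortComplex.mk (𝟙 X) g w)
  /-- identities are deflations -/
  id_deflation : ∀ X : A, ∃ (Z : A) (f : Z ⟶ X) (w : f ≫ 𝟙 X = 0),
    conflation (ShortComplex.mk f (𝟙 X) w)
  /-- inflations compose -/
  comp_inflation : ∀ {X Y Z : A} (f : X ⟶ Y) (f' : Y ⟶ Z),
    (∃ (C : A) (g : Y ⟶ C) (w : f ≫ g = 0), conflation (ShortComplex.mk f g w)) →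
    (∃ (C : A) (g : Z ⟶ C) (w : f' ≫ g = 0), conflation (ShortComplex.mk f' g w)) →
    ∃ (C : A) (g : Z ⟶ C) (w : (f ≫ f') ≫ g = 0), conflation (ShortComplex.mk (f ≫ f') g w)
  /-- deflations compose -/
  comp_deflation : ∀ {X Y Z : A} (g : X ⟶ Y) (g' : Y ⟶ Z),
    (∃ (K : A) (f : K ⟶ X) (w : f ≫ g = 0), conflation (ShortComplex.mk f g w)) →
    (∃ (K : A) (f : K ⟶ Y) (w : f ≫ g' = 0), conflation (ShortComplex.mk f g' w)) →
    ∃ (K : A) (f : K ⟶ X) (w : f ≫ g ≫ g' = 0), conflation (ShortComplex.mk f (g ≫ g') w)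
  /-- pushouts of inflations along arbitrary morphisms exist and are inflations -/
  pushout_inflation : ∀ {X Y X' : A} (i : X ⟶ Y) (h : X ⟶ X'),
    (∃ (C : A) (g : Y ⟶ C) (w : i ≫ g = 0), conflation (ShortComplex.mk i g w)) →
    ∃ (Y' : A) (h' : Y ⟶ Y') (i' : X' ⟶ Y'), IsPushout i h h' i' ∧
      ∃ (C : A) (g : Y' ⟶ C) (w : i' ≫ g = 0), conflation (ShortComplex.mk i' g w)
  /-- pullbacks of deflations along arbitrary morphisms exist and are deflations -/
  pullback_deflation : ∀ {Y Z Z' : A} (p : Y ⟶ Z) (h : Z' ⟶ Z),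
    (∃ (K : A) (f : K ⟶ Y) (w : f ≫ p = 0), conflation (ShortComplex.mk f p w)) →
    ∃ (Y' : A) (h' : Y' ⟶ Y) (p' : Y' ⟶ Z'), IsPullback h' p' p h ∧
      ∃ (K : A) (f : K ⟶ Y') (w : f ≫ p' = 0), conflation (ShortComplex.mk f p' w)

end Exact

namespace ExactStructure

variable {A : Type u} [Category.{v} A] [Preadditive A] [HasFiniteBiproducts A]
  (E : ExactStructure A)

/-- `X --i→ Y --p→ Z` is a conflation. -/
def Conf {X Y Z : A} (i : X ⟶ Y) (p : Y ⟶ Z) : Prop :=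
  ∃ w : i ≫ p = 0, E.conflation (ShortComplex.mk i p w)

/-- admissible monomorphisms -/
def Inflation {X Y : A} (i : X ⟶ Y) : Prop := ∃ (Z : A) (p : Y ⟶ Z), E.Conf i p

/-- admissible epimorphisms -/
def Deflation {Y Z : A} (p : Y ⟶ Z) : Prop := ∃ (X : A) (i : X ⟶ Y), E.Conf i p

/-- `P` is projective: every deflation ending at `P` splits. -/
def IsProjective : ObjectProperty A := fun P =>
  ∀ ⦃B : A⦄ (p : B ⟶ P), E.Deflation p → ∃ s : P ⟶ B, s ≫ p = 𝟙 P

/-- `Q` is injective: every inflation starting at `Q` splits. -/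
def IsInjective : ObjectProperty A := fun Q =>
  ∀ ⦃B : A⦄ (i : Q ⟶ B), E.Inflation i → ∃ r : B ⟶ Q, i ≫ r = 𝟙 Q

/-- A Frobenius category: enough projectives, enough injectives, and these coincide. -/
structure IsFrobenius : Prop where
  enough_proj : ∀ X : A, ∃ (P : A) (p : P ⟶ X), E.IsProjective P ∧ E.Deflation p
  enough_inj : ∀ X : A, ∃ (Q : A) (i : X ⟶ Q), E.IsInjective Q ∧ E.Inflation i
  proj_iff_inj : ∀ X : A, E.IsProjective X ↔ E.IsInjective X

/-! ### Orthogonality and cotorsion pairs -/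

/-- `Ext(a, b) = 0`, that is, the map `Ext(A₁, B₀) → Ext(A₀, B₁)` of Yoneda extension groups is
zero. The elements of `Ext(A₁, B₀)` are the classes of the conflations `B₀ ↣ C ↠ A₁`, and the zero
element is the class of the split ones. The map pushes out along `b` (the conflation
`B₁ ↣ C' ↠ A₁` below) and pulls back along `a` (the conflation `B₁ ↣ C'' ↠ A₀` below). A morphism
of conflations with an identity at the right, respectively left, end is a pushout, respectively a
pullback. -/
def ExtOrth {A₀ A₁ B₀ B₁ : A} (a : A₀ ⟶ A₁) (b : B₀ ⟶ B₁) : Prop :=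
  ∀ ⦃C C' C'' : A⦄ (i : B₀ ⟶ C) (p : C ⟶ A₁) (i' : B₁ ⟶ C') (p' : C' ⟶ A₁)
    (i'' : B₁ ⟶ C'') (p'' : C'' ⟶ A₀) (c : C ⟶ C') (c' : C'' ⟶ C'),
    E.Conf i p → E.Conf i' p' → E.Conf i'' p'' →
    i ≫ c = b ≫ i' → c ≫ p' = p →
    i'' ≫ c' = i' → c' ≫ p' = p'' ≫ a →
    ∃ s : A₀ ⟶ C'', s ≫ p'' = 𝟙 A₀

/-- `⊥M = {a | Ext(a, m) = 0 for all m ∈ M}` -/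
def leftPerp (M : MorphismProperty A) : MorphismProperty A := fun _ _ a =>
  ∀ ⦃B₀ B₁ : A⦄ (m : B₀ ⟶ B₁), M m → E.ExtOrth a m

/-- `M⊥ = {b | Ext(m, b) = 0 for all m ∈ M}` -/
def rightPerp (M : MorphismProperty A) : MorphismProperty A := fun _ _ b =>
  ∀ ⦃A₀ A₁ : A⦄ (m : A₀ ⟶ A₁), M m → E.ExtOrth m b

/-- A special `M`-precover `f : B ⟶ X`: a deflation and `M`-precover that fits in a pushout diagram
of conflations, from `K ↣ B' ↠ X` to `L ↣ B ↠ X`, along some `g : K ⟶ L` in `M⊥`. -/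
def IsSpecialPrecover (M : MorphismProperty A) {B X : A} (f : B ⟶ X) : Prop :=
  IsPrecover M f ∧
  ∃ (K B' L : A) (k : K ⟶ B') (q : B' ⟶ X) (l : L ⟶ B) (g : K ⟶ L) (h : B' ⟶ B),
    E.Conf k q ∧ E.Conf l f ∧ IsPushout k g h l ∧ h ≫ f = q ∧ E.rightPerp M g

/-- A special `M`-preenvelope `f : X ⟶ B`: an inflation and `M`-preenvelope that fits in a pullback
diagram of conflations, from `X ↣ B ↠ L` to `X ↣ B' ↠ K`, along some `g : L ⟶ K` in `⊥M`. -/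
def IsSpecialPreenvelope (M : MorphismProperty A) {X B : A} (f : X ⟶ B) : Prop :=
  IsPreenvelope M f ∧
  ∃ (K B' L : A) (k : B' ⟶ K) (q : X ⟶ B') (l : B ⟶ L) (g : L ⟶ K) (h : B ⟶ B'),
    E.Conf q k ∧ E.Conf f l ∧ IsPullback h l k g ∧ f ≫ h = q ∧ E.leftPerp M g

/-- A complete ideal cotorsion pair `(ℐ, 𝒥)`. -/
structure IsCompleteIdealCotorsionPair (I J : MorIdeal A) : Prop where
  left_eq : I.toProp = E.leftPerp J.toProp
  right_eq : J.toProp = E.rightPerp I.toProp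
  precover : ∀ X : A, ∃ (B : A) (f : B ⟶ X), E.IsSpecialPrecover I.toProp f
  preenvelope : ∀ X : A, ∃ (B : A) (f : X ⟶ B), E.IsSpecialPreenvelope J.toProp f

/-- `Ext¹(X, Y) = 0`: every conflation `Y ↣ C ↠ X` splits. -/
def ExtZero (X Y : A) : Prop :=
  ∀ ⦃C : A⦄ (i : Y ⟶ C) (p : C ⟶ X), E.Conf i p → ∃ s : X ⟶ C, s ≫ p = 𝟙 X

/-- A complete cotorsion pair `(𝒳, 𝒴)` of classes of objects. -/
structure IsCompleteCotorsionPair (P Q : ObjectProperty A) : Prop where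
  left_eq : ∀ X : A, P X ↔ ∀ Y : A, Q Y → E.ExtZero X Y
  right_eq : ∀ Y : A, Q Y ↔ ∀ X : A, P X → E.ExtZero X Y
  precover : ∀ M : A, ∃ (Y X : A) (i : Y ⟶ X) (p : X ⟶ M), E.Conf i p ∧ P X ∧ Q Y
  preenvelope : ∀ M : A, ∃ (Y X : A) (i : M ⟶ Y) (p : Y ⟶ X), E.Conf i p ∧ P X ∧ Q Y

/-! ### The stable category -/

/-- Two parallel morphisms are identified when their difference factors through a projective
object. -/
def stableRel : HomRel A := fun _ _ f g => factorsThrough E.IsProjective (f - g)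

variable {E}

lemma Deflation.exists_pullback {Y Z Z' : A} {p : Y ⟶ Z} (hp : E.Deflation p) (h : Z' ⟶ Z) :
    ∃ (Y' : A) (h' : Y' ⟶ Y) (p' : Y' ⟶ Z'), IsPullback h' p' p h ∧ E.Deflation p' := by
  obtain ⟨K, f, hf⟩ := hp
  obtain ⟨Y', h', p', hpb, K', f', hf'⟩ := E.pullback_deflation p h ⟨K, f, hf⟩
  exact ⟨Y', h', p', hpb, K', f', hf'⟩

lemma Inflation.exists_pushout {X Y X' : A} {i : X ⟶ Y} (hi : E.Inflation i) (h : X ⟶ X') :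
    ∃ (Y' : A) (h' : Y ⟶ Y') (i' : X' ⟶ Y'), IsPushout i h h' i' ∧ E.Inflation i' := by
  obtain ⟨K, f, hf⟩ := hi
  obtain ⟨Y', h', p', hpb, K', f', hf'⟩ := E.pushout_inflation i h ⟨K, f, hf⟩
  exact ⟨Y', h', p', hpb, K', f', hf'⟩

lemma IsProjective.exists_lift {P Y Z : A} (hP : E.IsProjective P) {p : Y ⟶ Z}
    (hp : E.Deflation p) (f : P ⟶ Z) : ∃ g : P ⟶ Y, g ≫ p = f := by
  obtain ⟨B, h', p', hpb, hp'⟩ := hp.exists_pullback f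
  obtain ⟨s, hs⟩ := hP p' hp'
  exact ⟨s ≫ h', by rw [Category.assoc, hpb.w, ← Category.assoc, hs, Category.id_comp]⟩

lemma IsInjective.exists_extend {Q X Y : A} (hQ : E.IsInjective Q) {i : X ⟶ Y}
    (hi : E.Inflation i) (f : X ⟶ Q) : ∃ g : Y ⟶ Q, i ≫ g = f := by
  obtain ⟨B, h', i', hpo, hi'⟩ := hi.exists_pushout f
  obtain ⟨r, hr⟩ := hQ i' hi'
  exact ⟨h' ≫ r, by rw [← Category.assoc, hpo.w, Category.assoc, hr, Category.comp_id]⟩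

variable (E)

section Congruence

open scoped ZeroObject

attribute [local instance] hasBinaryBiproducts_of_finite_biproducts

lemma isProjective_zero : E.IsProjective (0 : A) := fun _ _ _ =>
  ⟨0, (isZero_zero A).eq_of_src _ _⟩

lemma isProjective_biprod {P Q : A} (hP : E.IsProjective P) (hQ : E.IsProjective Q) :
    E.IsProjective (P ⊞ Q) := fun B p hp => by
  obtain ⟨s, hs⟩ := hP.exists_lift hp biprod.inl
  obtain ⟨t, ht⟩ := hQ.exists_lift hp biprod.inr
  exact ⟨biprod.desc s t, by ext <;> simp [hs, ht]⟩

lemma stableRel_add {X Y : A} {f g : X ⟶ Y} (hf : factorsThrough E.IsProjective f)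
    (hg : factorsThrough E.IsProjective g) : factorsThrough E.IsProjective (f + g) := by
  obtain ⟨P, s, t, hP, rfl⟩ := hf
  obtain ⟨Q, s', t', hQ, rfl⟩ := hg
  exact ⟨P ⊞ Q, biprod.lift s s', biprod.desc t t', E.isProjective_biprod hP hQ, by simp⟩

instance stableRel_congruence : Congruence E.stableRel where
  comp_left := by
    rintro X Y Z f g g' ⟨P, s, t, hP, h⟩
    exact ⟨P, f ≫ s, t, hP, by rw [Category.assoc, h, Preadditive.comp_sub]⟩
  comp_right := by
    rintro X Y Z f f' g ⟨P, s, t, hP, h⟩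
    exact ⟨P, s, t ≫ g, hP, by rw [← Category.assoc, h, Preadditive.sub_comp]⟩
  equivalence :=
    { refl := fun f => ⟨0, 0, 0, E.isProjective_zero, by simp⟩
      symm := by
        rintro f g ⟨P, s, t, hP, h⟩
        exact ⟨P, s, -t, hP, by rw [Preadditive.comp_neg, h, neg_sub]⟩
      trans := by
        intro f g h hfg hgh
        have := E.stableRel_add hfg hgh
        rwa [sub_add_sub_cancel] at this }

end Congruence

/-- The stable category `𝒜/ω`. -/
abbrev Stable : Type u := CategoryTheory.Quotient E.stableRel

/-- The projection `𝒜 ⥤ 𝒜/ω`, `X ↦ X̲`. -/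
abbrev toStable : A ⥤ E.Stable := CategoryTheory.Quotient.functor E.stableRel

instance stablePreadditive : Preadditive E.Stable :=
  CategoryTheory.Quotient.preadditive E.stableRel (by
    intro X Y f₁ f₂ g₁ g₂ hf hg
    have := E.stableRel_add hf hg
    rwa [sub_add_sub_comm] at this)

/-! ### The suspension of the stable category and its triangles -/

variable {E}

namespace IsFrobenius

lemma exists_inj (hE : E.IsFrobenius) (X : A) :
    ∃ Q : A, E.IsInjective Q ∧ ∃ (T : A) (m : X ⟶ Q) (p : Q ⟶ T), E.Conf m p := by
  obtain ⟨Q, i, hQ, Z, p, h⟩ := hE.enough_inj X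
  exact ⟨Q, hQ, Z, i, p, h⟩

/-- For every `X`, a conflation `X ↣ I(X) ↠ T(X)` with `I(X)` injective is chosen; this is
`I(X)`. -/
noncomputable def inj (hE : E.IsFrobenius) (X : A) : A := (hE.exists_inj X).choose

/-- The object `T(X)` of the chosen conflation `X ↣ I(X) ↠ T(X)`. -/
noncomputable def susp (hE : E.IsFrobenius) (X : A) : A := (hE.exists_inj X).choose_spec.2.choose

/-- The inflation of the chosen conflation `X ↣ I(X) ↠ T(X)`. -/
noncomputable def ι (hE : E.IsFrobenius) (X : A) : X ⟶ hE.inj X :=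
  (hE.exists_inj X).choose_spec.2.choose_spec.choose

/-- The deflation of the chosen conflation `X ↣ I(X) ↠ T(X)`. -/
noncomputable def π (hE : E.IsFrobenius) (X : A) : hE.inj X ⟶ hE.susp X :=
  (hE.exists_inj X).choose_spec.2.choose_spec.choose_spec.choose

lemma inj_isInjective (hE : E.IsFrobenius) (X : A) : E.IsInjective (hE.inj X) :=
  (hE.exists_inj X).choose_spec.1

lemma conf (hE : E.IsFrobenius) (X : A) : E.Conf (hE.ι X) (hE.π X) :=
  (hE.exists_inj X).choose_spec.2.choose_spec.choose_spec.choose_spec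

lemma exists_susp_map (hE : E.IsFrobenius) {X Y : A} (f : X ⟶ Y) :
    ∃ (h : hE.susp X ⟶ hE.susp Y) (g : hE.inj X ⟶ hE.inj Y),
      hE.ι X ≫ g = f ≫ hE.ι Y ∧ g ≫ hE.π Y = hE.π X ≫ h := by
  obtain ⟨g, hg⟩ := (hE.inj_isInjective Y).exists_extend ⟨_, _, hE.conf X⟩ (f ≫ hE.ι Y)
  obtain ⟨wY, _⟩ := hE.conf Y
  obtain ⟨wX, cX⟩ := hE.conf X
  obtain ⟨hc⟩ := E.isCokernel cX
  obtain ⟨h, hh⟩ := CokernelCofork.IsColimit.desc' hc (g ≫ hE.π Y)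
    (by dsimp; rw [← Category.assoc, hg, Category.assoc, wY, comp_zero])
  exact ⟨h, g, hg, hh.symm⟩

/-- A lift `T(X) ⟶ T(Y)` to `𝒜` of the suspension of `f`: it fits in a chosen morphism of
conflations from `X ↣ I(X) ↠ T(X)` to `Y ↣ I(Y) ↠ T(Y)` that extends `f`. -/
noncomputable def suspMap (hE : E.IsFrobenius) {X Y : A} (f : X ⟶ Y) :
    hE.susp X ⟶ hE.susp Y := (hE.exists_susp_map f).choose

lemma suspMap_spec (hE : E.IsFrobenius) {X Y : A} (f : X ⟶ Y) :
    ∃ g : hE.inj X ⟶ hE.inj Y,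
      hE.ι X ≫ g = f ≫ hE.ι Y ∧ g ≫ hE.π Y = hE.π X ≫ hE.suspMap f :=
  (hE.exists_susp_map f).choose_spec

lemma stableRel_susp (hE : E.IsFrobenius) {X Y : A} {f f' : X ⟶ Y} (hff' : E.stableRel f f')
    {h h' : hE.susp X ⟶ hE.susp Y} {g g' : hE.inj X ⟶ hE.inj Y}
    (hg : hE.ι X ≫ g = f ≫ hE.ι Y) (hh : g ≫ hE.π Y = hE.π X ≫ h)
    (hg' : hE.ι X ≫ g' = f' ≫ hE.ι Y) (hh' : g' ≫ hE.π Y = hE.π X ≫ h') :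
    E.stableRel h h' := by
  obtain ⟨P, s, t, hP, hst⟩ := hff'
  obtain ⟨s', hs'⟩ := ((hE.proj_iff_inj P).1 hP).exists_extend ⟨_, _, hE.conf X⟩ s
  obtain ⟨wY, _⟩ := hE.conf Y
  obtain ⟨wX, cX⟩ := hE.conf X
  obtain ⟨hc⟩ := E.isCokernel cX
  obtain ⟨r, hr⟩ := CokernelCofork.IsColimit.desc' hc (g - g' - s' ≫ t ≫ hE.ι Y)
    (by
      dsimp
      rw [Preadditive.comp_sub, Preadditive.comp_sub, hg, hg', ← Category.assoc _ s', hs',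
        ← Preadditive.sub_comp, ← hst, Category.assoc, sub_self])
  have hr' : hE.π X ≫ r = g - g' - s' ≫ t ≫ hE.ι Y := hr
  have hepi : Epi (hE.π X) := Cofork.IsColimit.epi hc
  refine ⟨_, r, hE.π Y, (hE.proj_iff_inj _).2 (hE.inj_isInjective Y), ?_⟩
  rw [← cancel_epi (hE.π X), ← Category.assoc, hr', Preadditive.comp_sub, ← hh, ← hh']
  simp [Preadditive.sub_comp, wY]

/-- The suspension functor `[1] = T` of the stable category. -/
noncomputable def shift (hE : E.IsFrobenius) : E.Stable ⥤ E.Stable :=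
  CategoryTheory.Quotient.lift E.stableRel
    { obj := fun X => E.toStable.obj (hE.susp X)
      map := fun f => E.toStable.map (hE.suspMap f)
      map_id := fun X => by
        obtain ⟨g, h₁, h₂⟩ := hE.suspMap_spec (𝟙 X)
        rw [← E.toStable.map_id]
        exact CategoryTheory.Quotient.sound _ (hE.stableRel_susp (Congruence.equivalence.refl (𝟙 X)) h₁ h₂
          (g' := 𝟙 _) (by simp) (by simp))
      map_comp := fun {X Y Z} f f' => by
        obtain ⟨g, h₁, h₂⟩ := hE.suspMap_spec (f ≫ f')
        obtain ⟨k, k₁, k₂⟩ := hE.suspMap_spec f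
        obtain ⟨l, l₁, l₂⟩ := hE.suspMap_spec f'
        rw [← E.toStable.map_comp]
        exact CategoryTheory.Quotient.sound _ (hE.stableRel_susp (Congruence.equivalence.refl (f ≫ f')) h₁ h₂
          (g' := k ≫ l) (by rw [← Category.assoc, k₁, Category.assoc, l₁, Category.assoc])
          (by rw [Category.assoc, l₂, ← Category.assoc, k₂, Category.assoc])) }
    (by
      intro X Y f f' h
      obtain ⟨g, h₁, h₂⟩ := hE.suspMap_spec f
      obtain ⟨g', h₁', h₂'⟩ := hE.suspMap_spec f'
      exact CategoryTheory.Quotient.sound _ (hE.stableRel_susp h h₁ h₂ h₁' h₂'))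

/-- `X̲ ⟶ Y̲ ⟶ Z̲ ⟶ X̲[1]` is a distinguished triangle of `𝒜/ω`: it is isomorphic to a standard
triangle `X̲' ⟶ Y̲' ⟶ C̲ ⟶ X̲'[1]`, given by the pushout of the chosen conflation
`X' ↣ I(X') ↠ T(X')` along a morphism `f : X' ⟶ Y'`, which is a morphism of conflations to
`Y' ↣ C ↠ T(X')` with the identity at the right end. -/
def IsTriangle (hE : E.IsFrobenius) {X Y Z : E.Stable} (u : X ⟶ Y) (v : Y ⟶ Z)
    (w : Z ⟶ hE.shift.obj X) : Prop :=
  ∃ (X' Y' C : A) (f : X' ⟶ Y') (i : hE.inj X' ⟶ C) (v' : Y' ⟶ C) (w' : C ⟶ hE.susp X'),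
    IsPushout (hE.ι X') f i v' ∧ i ≫ w' = hE.π X' ∧ E.Conf v' w' ∧
    ∃ (a : X ≅ E.toStable.obj X') (b : Y ≅ E.toStable.obj Y') (c : Z ≅ E.toStable.obj C),
      u ≫ b.hom = a.hom ≫ E.toStable.map f ∧
      v ≫ c.hom = b.hom ≫ E.toStable.map v' ∧
      w ≫ hE.shift.map a.hom = c.hom ≫ E.toStable.map w'

end IsFrobenius

end ExactStructure

end IdealApprox

namespace IdealApprox

namespace ExactStructure

attribute [local instance] hasBinaryBiproducts_of_finite_biproducts

section Exact

variable {A : Type u} [Category.{v} A] [Preadditive A] [HasFiniteBiproducts A]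
  {E : ExactStructure A}

/-! ### Conflations -/

/-! Write 𝒳 = Ob(ℐ), 𝒴 = Ob(𝒥), and I(C) for the chosen injective hull of C. Every M has a
conflation M ↣ C ↠ X with X ∈ 𝒳 and inflation in 𝒥: the morphism of ℐ behind a special 𝒥-preenvelope
factors through some X ∈ 𝒳, and pulling back along the second factor is enough
(`exists_conf_left_ob`). The inflation factors through some Y ∈ 𝒴, and Ext¹(X, Y) = 0 extends the
first factor over C. So 1_C is the sum of a map through Y and a map through X (`exists_id_eq`), and
C is a retract of X ⊕ Y. If C in turn embeds in an object of 𝒴 with cokernel in 𝒳, then so does M,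
because 𝒳 is closed under extensions; Salce's trick gives the other half of completeness. This is
(3) ⇒ (1).

Stable data are realised in 𝒜 by adding an injective hull to the target: a stable retraction becomes
a split inflation, and a stable isomorphism an inflation with projective cokernel
(`exists_conf_of_stable_retraction`, `exists_conf_of_stable_iso`). This turns triangles into
conflations. It also supplies the complement that a direct summand needs, since a retract in 𝒜 need
not have one.

In the Krull–Schmidt case, C decomposes stably into summands L with local endomorphism rings. The
two parts of 1_C, compressed to L, add up to 1, so one of them is a stable automorphism. Either L is
a stable retract of Y, hence in 𝒴, or L embeds stably as a summand of X and can be cancelled from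
both C and X, leaving only I(L) ∈ 𝒴 behind (`ob_or_exists_conf_inj_biprod`). After finitely many
steps the middle term lies in 𝒴. -/

lemma Conf.zero {X Y Z : A} {i : X ⟶ Y} {p : Y ⟶ Z} (h : E.Conf i p) : i ≫ p = 0 := h.1

lemma Conf.mono {X Y Z : A} {i : X ⟶ Y} {p : Y ⟶ Z} (h : E.Conf i p) : Mono i := by
  obtain ⟨w, c⟩ := h
  obtain ⟨hk⟩ := E.isKernel c
  exact Fork.IsLimit.mono hk

lemma Conf.epi {X Y Z : A} {i : X ⟶ Y} {p : Y ⟶ Z} (h : E.Conf i p) : Epi p := by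
  obtain ⟨w, c⟩ := h
  obtain ⟨hk⟩ := E.isCokernel c
  exact Cofork.IsColimit.epi hk

lemma Conf.exists_lift {X Y Z W : A} {i : X ⟶ Y} {p : Y ⟶ Z} (h : E.Conf i p) (k : W ⟶ Y)
    (hk : k ≫ p = 0) : ∃ l : W ⟶ X, l ≫ i = k := by
  obtain ⟨w, c⟩ := h
  obtain ⟨hl⟩ := E.isKernel c
  obtain ⟨l, hl⟩ := KernelFork.IsLimit.lift' hl k hk
  exact ⟨l, hl⟩

lemma Conf.exists_desc {X Y Z W : A} {i : X ⟶ Y} {p : Y ⟶ Z} (h : E.Conf i p) (k : Y ⟶ W)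
    (hk : i ≫ k = 0) : ∃ l : Z ⟶ W, p ≫ l = k := by
  obtain ⟨w, c⟩ := h
  obtain ⟨hl⟩ := E.isCokernel c
  obtain ⟨l, hl⟩ := CokernelCofork.IsColimit.desc' hl k hk
  exact ⟨l, hl⟩

lemma Conf.of_iso {X Y Z X' Y' Z' : A} {i : X ⟶ Y} {p : Y ⟶ Z} (h : E.Conf i p)
    {i' : X' ⟶ Y'} {p' : Y' ⟶ Z'} (a : X ≅ X') (b : Y ≅ Y') (c : Z ≅ Z')
    (hi : a.hom ≫ i' = i ≫ b.hom) (hp : b.hom ≫ p' = p ≫ c.hom) : E.Conf i' p' := by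
  obtain ⟨w, h⟩ := h
  have w' : i' ≫ p' = 0 := by
    rw [← cancel_epi a.hom, ← Category.assoc, hi, Category.assoc, hp, ← Category.assoc, w]
    simp
  exact ⟨w', E.of_iso (ShortComplex.isoMk a b c hi hp) h⟩

/-- A kernel of a deflation is the inflation of a conflation. -/
lemma Deflation.conf_of_kernel {X Y Z : A} {p : Y ⟶ Z} (hp : E.Deflation p) (i : X ⟶ Y) [Mono i]
    (w : i ≫ p = 0) (hi : ∀ ⦃W : A⦄ (k : W ⟶ Y), k ≫ p = 0 → ∃ l : W ⟶ X, l ≫ i = k) :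
    E.Conf i p := by
  obtain ⟨X₀, i₀, h⟩ := hp
  obtain ⟨a, ha⟩ := hi i₀ h.zero
  obtain ⟨b, hb⟩ := h.exists_lift i w
  have := h.mono
  refine h.of_iso ⟨a, b, ?_, ?_⟩ (Iso.refl _) (Iso.refl _) (by simp [ha]) (by simp)
  · rw [← cancel_mono i₀, Category.assoc, hb, ha, Category.id_comp]
  · rw [← cancel_mono i, Category.assoc, ha, hb, Category.id_comp]

/-- A cokernel of an inflation is the deflation of a conflation. -/
lemma Inflation.conf_of_cokernel {X Y Z : A} {i : X ⟶ Y} (hi : E.Inflation i) (p : Y ⟶ Z) [Epi p]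
    (w : i ≫ p = 0) (hp : ∀ ⦃W : A⦄ (k : Y ⟶ W), i ≫ k = 0 → ∃ l : Z ⟶ W, p ≫ l = k) :
    E.Conf i p := by
  obtain ⟨Z₀, p₀, h⟩ := hi
  obtain ⟨a, ha⟩ := hp p₀ h.zero
  obtain ⟨b, hb⟩ := h.exists_desc p w
  have := h.epi
  refine h.of_iso (Iso.refl _) (Iso.refl _) ⟨b, a, ?_, ?_⟩ (by simp) (by simp [hb])
  · rw [← cancel_epi p₀, ← Category.assoc, hb, ha, Category.comp_id]
  · rw [← cancel_epi p, ← Category.assoc, ha, hb, Category.comp_id]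

/-- The pullback of a conflation is a conflation with the same kernel. -/
lemma Conf.of_isPullback {X Y Z Y' Z' : A} {i : X ⟶ Y} {p : Y ⟶ Z} (h : E.Conf i p)
    {h' : Y' ⟶ Y} {p' : Y' ⟶ Z'} {f : Z' ⟶ Z} (sq : IsPullback h' p' p f) :
    ∃ i' : X ⟶ Y', E.Conf i' p' ∧ i' ≫ h' = i := by
  obtain ⟨Y₀, h₀, p₀, sq₀, K, k, hk⟩ := E.pullback_deflation p f ⟨X, i, h⟩
  have hp' : E.Deflation p' := by
    exact ⟨K, k ≫ (sq₀.isoIsPullback _ _ sq).hom, Conf.of_iso (E := E) hk (Iso.refl _)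
      (sq₀.isoIsPullback _ _ sq) (Iso.refl _) (by simp) (by simp)⟩
  let i' : X ⟶ Y' := sq.lift i 0 (by rw [h.zero, zero_comp])
  have h₁ : i' ≫ h' = i := sq.lift_fst _ _ _
  have h₂ : i' ≫ p' = 0 := sq.lift_snd _ _ _
  have := h.mono
  have : Mono i' := mono_of_mono_fac h₁
  refine ⟨i', hp'.conf_of_kernel i' h₂ fun W k hk => ?_, h₁⟩
  obtain ⟨l, hl⟩ := h.exists_lift (k ≫ h')
    (by rw [Category.assoc, sq.w, ← Category.assoc, hk, zero_comp])
  exact ⟨l, sq.hom_ext (by rw [Category.assoc, h₁, hl]) (by rw [Category.assoc, h₂, hk, comp_zero])⟩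

/-- The pushout of a conflation is a conflation with the same cokernel. -/
lemma Conf.of_isPushout {X Y Z X' Y' : A} {i : X ⟶ Y} {p : Y ⟶ Z} (h : E.Conf i p)
    {f : X ⟶ X'} {h' : Y ⟶ Y'} {i' : X' ⟶ Y'} (sq : IsPushout i f h' i') :
    ∃ p' : Y' ⟶ Z, E.Conf i' p' ∧ h' ≫ p' = p := by
  obtain ⟨Y₀, h₀, i₀, sq₀, K, k, hk⟩ := E.pushout_inflation i f ⟨Z, p, h⟩
  have hi' : E.Inflation i' :=
    ⟨K, (sq₀.isoIsPushout _ _ sq).inv ≫ k, Conf.of_iso (E := E) hk (Iso.refl _)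
      (sq₀.isoIsPushout _ _ sq) (Iso.refl _) (by simp) (by simp)⟩
  let p' : Y' ⟶ Z := sq.desc p 0 (by rw [h.zero, comp_zero])
  have h₁ : h' ≫ p' = p := sq.inl_desc _ _ _
  have h₂ : i' ≫ p' = 0 := sq.inr_desc _ _ _
  have := h.epi
  have : Epi p' := epi_of_epi_fac h₁
  refine ⟨p', hi'.conf_of_cokernel p' h₂ fun W k hk => ?_, h₁⟩
  obtain ⟨l, hl⟩ := h.exists_desc (h' ≫ k)
    (by rw [← Category.assoc, sq.w, Category.assoc, hk, comp_zero])
  exact ⟨l, sq.hom_ext (by rw [← Category.assoc, h₁, hl])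
    (by rw [← Category.assoc, h₂, hk, zero_comp])⟩

lemma Conf.exists_isPullback {X Y Z Z' : A} {i : X ⟶ Y} {p : Y ⟶ Z} (h : E.Conf i p)
    (f : Z' ⟶ Z) : ∃ (Y' : A) (h' : Y' ⟶ Y) (p' : Y' ⟶ Z') (i' : X ⟶ Y'),
      IsPullback h' p' p f ∧ E.Conf i' p' ∧ i' ≫ h' = i := by
  obtain ⟨Y', h', p', sq, -⟩ := E.pullback_deflation p f ⟨X, i, h⟩
  obtain ⟨i', hi', e⟩ := h.of_isPullback sq
  exact ⟨Y', h', p', i', sq, hi', e⟩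

lemma Conf.exists_isPushout {X Y Z X' : A} {i : X ⟶ Y} {p : Y ⟶ Z} (h : E.Conf i p)
    (f : X ⟶ X') : ∃ (Y' : A) (h' : Y ⟶ Y') (i' : X' ⟶ Y') (p' : Y' ⟶ Z),
      IsPushout i f h' i' ∧ E.Conf i' p' ∧ h' ≫ p' = p := by
  obtain ⟨Y', h', i', sq, -⟩ := E.pushout_inflation i f ⟨Z, p, h⟩
  obtain ⟨p', hp', e⟩ := h.of_isPushout sq
  exact ⟨Y', h', i', p', sq, hp', e⟩

/-- A retraction of the inflation of a conflation gives a splitting. -/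
lemma Conf.exists_splitting {X Y Z : A} {i : X ⟶ Y} {p : Y ⟶ Z} (h : E.Conf i p) {r : Y ⟶ X}
    (hr : i ≫ r = 𝟙 X) :
    ∃ s : Z ⟶ Y, s ≫ p = 𝟙 Z ∧ s ≫ r = 0 ∧ r ≫ i + p ≫ s = 𝟙 Y := by
  obtain ⟨s, hs⟩ := h.exists_desc (𝟙 Y - r ≫ i)
    (by rw [Preadditive.comp_sub, ← Category.assoc, hr]; simp)
  have := h.epi
  refine ⟨s, ?_, ?_, by rw [hs]; abel⟩
  · rw [← cancel_epi p, ← Category.assoc, hs, Preadditive.sub_comp, Category.assoc, h.zero]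
    simp
  · rw [← cancel_epi p, ← Category.assoc, hs, Preadditive.sub_comp, Category.assoc, hr]
    simp

/-- Over a conflation, a section of the deflation gives a retraction of the inflation. -/
lemma Conf.exists_retraction {X Y Z : A} {i : X ⟶ Y} {p : Y ⟶ Z} (h : E.Conf i p) {s : Z ⟶ Y}
    (hs : s ≫ p = 𝟙 Z) : ∃ r : Y ⟶ X, i ≫ r = 𝟙 X := by
  obtain ⟨r, hr⟩ := h.exists_lift (𝟙 Y - p ≫ s)
    (by rw [Preadditive.sub_comp, Category.assoc, hs]; simp)
  have := h.mono
  refine ⟨r, ?_⟩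
  rw [← cancel_mono i, Category.assoc, hr, Preadditive.comp_sub, ← Category.assoc, h.zero]
  simp

lemma conf_id_zero (X : A) {Z : A} (hZ : IsZero Z) : E.Conf (𝟙 X) (0 : X ⟶ Z) := by
  obtain ⟨Z', g, h⟩ := E.id_inflation X
  have : Epi (0 : X ⟶ Z) := ⟨fun _ _ _ => hZ.eq_of_src _ _⟩
  have hX : E.Inflation (𝟙 X) := ⟨Z', g, h⟩
  exact hX.conf_of_cokernel _ (by simp) fun W k hk =>
    ⟨0, by rw [Category.id_comp] at hk; simp [hk]⟩

open scoped ZeroObject in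
/-- Split short exact sequences are conflations. -/
lemma conf_of_splitting {X Y Z : A} (i : X ⟶ Y) (p : Y ⟶ Z) (r : Y ⟶ X) (s : Z ⟶ Y)
    (hr : i ≫ r = 𝟙 X) (hs : s ≫ p = 𝟙 Z) (hz : i ≫ p = 0) (ht : r ≫ i + p ≫ s = 𝟙 Y) :
    E.Conf i p := by
  have hsr : s ≫ r = 0 := by
    have : s ≫ (r ≫ i + p ≫ s) ≫ r = s ≫ r := by rw [ht, Category.id_comp]
    simpa [hr, reassoc_of% hs] using this
  -- The split sequence is the pullback of X = X → 0 along Z → 0.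
  have sq : IsPullback r p (0 : X ⟶ (0 : A)) (0 : Z ⟶ (0 : A)) := by
    refine IsPullback.of_isLimit (PullbackCone.IsLimit.mk (by simp)
      (fun c => c.fst ≫ i + c.snd ≫ s) (fun c => ?_) (fun c => ?_) fun c m h₁ h₂ => ?_)
    · simp [hr, hsr]
    · simp [hz, hs]
    · rw [← h₁, ← h₂, Category.assoc, Category.assoc, ← Preadditive.comp_add, ht, Category.comp_id]
  obtain ⟨i', hi', e⟩ := (conf_id_zero (E := E) X (isZero_zero A)).of_isPullback sq
  have : i' = i := by
    rw [← Category.comp_id i', ← ht, Preadditive.comp_add, reassoc_of% e, reassoc_of% hi'.zero]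
    simp
  exact this ▸ hi'

/-- The composition of inflations, with a conflation between the cokernels. -/
lemma Conf.comp {M C X N X' : A} {f : M ⟶ C} {p : C ⟶ X} {j : C ⟶ N} {q : N ⟶ X'}
    (h : E.Conf f p) (h' : E.Conf j q) :
    ∃ (W : A) (w : N ⟶ W) (a : X ⟶ W) (b : W ⟶ X'), E.Conf (f ≫ j) w ∧ E.Conf a b := by
  -- The pushout W plays the role of N/M: it contains X = C/M with quotient X' = N/C.
  obtain ⟨W, w, a, b, sq, hab, -⟩ := h'.exists_isPushout p
  refine ⟨W, w, a, b, ?_, hab⟩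
  have := h.epi
  have hw : Epi w := ⟨fun u v huv => sq.hom_ext huv (by
    rw [← cancel_epi p, ← Category.assoc, ← Category.assoc, ← sq.w, Category.assoc, huv,
      Category.assoc])⟩
  refine Inflation.conf_of_cokernel (E.comp_inflation f j ⟨_, _, h⟩ ⟨_, _, h'⟩) w
    (by rw [Category.assoc, sq.w, reassoc_of% h.zero, zero_comp]) fun V k hk => ?_
  obtain ⟨l, hl⟩ := h.exists_desc (j ≫ k) (by rw [← Category.assoc, hk])
  exact ⟨sq.desc k l hl.symm, sq.inl_desc _ _ _⟩

/-- `biprod.map i (𝟙 B)` is the pushout of `i` along the inclusion of X in X ⊕ B. -/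
lemma Conf.biprod_map_id {X Y Z : A} {i : X ⟶ Y} {p : Y ⟶ Z} (h : E.Conf i p) (B : A) :
    ∃ p' : Y ⊞ B ⟶ Z, E.Conf (biprod.map i (𝟙 B)) p' := by
  have sq : IsPushout i (biprod.inl : X ⟶ X ⊞ B) (biprod.inl : Y ⟶ Y ⊞ B)
      (biprod.map i (𝟙 B)) := by
    refine IsPushout.of_isColimit (PushoutCocone.IsColimit.mk (inr := biprod.map i (𝟙 B)) (by simp)
      (fun c => biprod.desc c.inl (biprod.inr ≫ c.inr)) (fun c => by simp) (fun c => ?_)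
      fun c m h₁ h₂ => ?_)
    · ext
      · simp [c.condition]
      · simp
    · ext
      · simp [h₁]
      · simp [← h₂]
  obtain ⟨p', hp', -⟩ := h.of_isPushout sq
  exact ⟨p', hp'⟩

lemma Conf.id_biprod_map {X Y Z : A} {i : X ⟶ Y} {p : Y ⟶ Z} (h : E.Conf i p) (B : A) :
    E.Conf (i ≫ biprod.inr) (biprod.map (𝟙 B) p) := by
  have sq : IsPullback (biprod.snd : B ⊞ Y ⟶ Y) (biprod.map (𝟙 B) p) p
      (biprod.snd : B ⊞ Z ⟶ Z) := by
    refine IsPullback.of_isLimit (PullbackCone.IsLimit.mk (snd := biprod.map (𝟙 B) p) (by simp)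
      (fun c => biprod.lift (c.snd ≫ biprod.fst) c.fst) (fun c => by simp) (fun c => ?_)
      fun c m h₁ h₂ => ?_)
    · ext
      · simp
      · simp [c.condition]
    · ext
      · simp [← h₂]
      · simp [h₁]
  obtain ⟨i', hi', e⟩ := h.of_isPullback sq
  have : i' = i ≫ biprod.inr := by
    ext
    · simpa using hi'.zero =≫ biprod.fst
    · simpa using e
  exact this ▸ hi'

/-- A morphism with an inflation as first component is an inflation. -/
lemma Inflation.biprod_lift {X Q : A} {i : X ⟶ Q} (hi : E.Inflation i) {B : A} (g : X ⟶ B) :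
    E.Inflation (biprod.lift i g) := by
  obtain ⟨T, p, h⟩ := hi
  -- (i, g) is the graph (1, g), a split inflation, followed by i ⊕ 1.
  have h₁ : E.Conf (biprod.lift (𝟙 X) g) (biprod.desc (-g) (𝟙 B)) :=
    conf_of_splitting _ _ biprod.fst biprod.inr (by simp) (by simp) (by simp) (by
      ext <;> simp)
  obtain ⟨p', h₂⟩ := h.biprod_map_id B
  obtain ⟨W, w, -, -, hw, -⟩ := h₁.comp h₂
  have e : biprod.lift (𝟙 X) g ≫ biprod.map i (𝟙 B) = biprod.lift i g := by ext <;> simp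
  exact ⟨W, w, e ▸ hw⟩

/-- The conflation `X ↣ Q ⊕ B ↠ C` of the pushout `C` of an inflation `X ↣ Q`. -/
lemma Inflation.conf_of_isPushout {X Q B C : A} {i : X ⟶ Q} (hi : E.Inflation i) {f : X ⟶ B}
    {a : Q ⟶ C} {b : B ⟶ C} (sq : IsPushout i f a b) :
    E.Conf (biprod.lift i f) (biprod.desc a (-b)) := by
  have : Epi (biprod.desc a (-b)) := ⟨fun u v huv => sq.hom_ext
    (by simpa using biprod.inl ≫= huv) (by simpa using biprod.inr ≫= huv)⟩
  refine (hi.biprod_lift f).conf_of_cokernel _ (by simp [sq.w]) fun W k hk => ?_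
  have hk' : i ≫ biprod.inl ≫ k + f ≫ biprod.inr ≫ k = 0 := by
    rw [biprod.lift_eq] at hk
    simpa using hk
  refine ⟨sq.desc (biprod.inl ≫ k) (-(biprod.inr ≫ k)) ?_, ?_⟩
  · rw [Preadditive.comp_neg]
    exact eq_neg_of_add_eq_zero_left hk'
  · ext <;> simp

/-- Cancellation: in a conflation `M ↣ L ⊕ T ↠ X` for which `L ⟶ X` is a split monomorphism with
cokernel `W`, the summand `L` can be removed. -/
lemma Conf.cancel {M X W L T : A} (b : BinaryBicone L T)
    (hb : b.fst ≫ b.inl + b.snd ≫ b.inr = 𝟙 b.pt) {f : M ⟶ b.pt} {p : b.pt ⟶ X}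
    (h : E.Conf f p) {w : X ⟶ W} (hw : E.Conf (b.inl ≫ p) w) {r : X ⟶ L}
    (hr : (b.inl ≫ p) ≫ r = 𝟙 L) : E.Conf (f ≫ b.snd) (b.inr ≫ p ≫ w) := by
  obtain ⟨s, hs, hsr, ht⟩ := hw.exists_splitting hr
  have hr' : b.inl ≫ p ≫ r = 𝟙 L := by simpa using hr
  have hw0 : b.inl ≫ p ≫ w = 0 := by simpa using hw.zero
  -- `t` corrects the inclusion of T by an element of L so that its image in X has no L-component;
  -- it identifies T with the preimage under `p` of the complement W of L. The new conflation is
  -- thus the pullback of the old one along `s : W ⟶ X`.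
  let t : T ⟶ b.pt := b.inr - b.inr ≫ p ≫ r ≫ b.inl
  have htr : t ≫ p ≫ r = 0 := by simp [t, hr']
  have htw : t ≫ p ≫ w = b.inr ≫ p ≫ w := by simp [t, hw0]
  have htb : t ≫ b.snd = 𝟙 T := by simp [t]
  have key : ∀ ⦃V : A⦄ (y : V ⟶ b.pt), y ≫ p ≫ r = 0 → (y ≫ b.snd) ≫ t = y := by
    intro V y hy
    have h₁ : y ≫ (b.fst ≫ b.inl + b.snd ≫ b.inr) = y := by rw [hb, Category.comp_id]
    have h₂ : y ≫ b.fst + y ≫ b.snd ≫ b.inr ≫ p ≫ r = 0 := by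
      have : (y ≫ (b.fst ≫ b.inl + b.snd ≫ b.inr)) ≫ p ≫ r = 0 := by rw [h₁, hy]
      simpa [hr'] using this
    have h₃ : y ≫ b.snd ≫ b.inr ≫ p ≫ r = - (y ≫ b.fst) := (neg_eq_of_add_eq_zero_right h₂).symm
    have h₄ : y ≫ b.snd ≫ b.inr ≫ p ≫ r ≫ b.inl = - (y ≫ b.fst ≫ b.inl) := by
      simpa using h₃ =≫ b.inl
    rw [← h₁]
    simp only [t, Preadditive.comp_sub, Category.assoc, Preadditive.comp_add,
      Preadditive.add_comp]
    simp [h₄, add_comm]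
  have sq : IsPullback t (b.inr ≫ p ≫ w) p s := by
    refine IsPullback.of_isLimit (PullbackCone.IsLimit.mk ?_
      (fun c => c.fst ≫ b.snd) (fun c => ?_) (fun c => ?_) fun c m h₁ h₂ => ?_)
    · rw [← htw]
      have : (t ≫ p) ≫ (r ≫ b.inl ≫ p + w ≫ s) = t ≫ p := by rw [ht, Category.comp_id]
      rw [← this]
      simp [reassoc_of% htr]
    · refine key _ ?_
      rw [← Category.assoc, c.condition, Category.assoc, hsr, comp_zero]
    · have hc : c.fst ≫ p ≫ r = 0 := by
        rw [← Category.assoc, c.condition, Category.assoc, hsr, comp_zero]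
      rw [← htw, ← Category.assoc, key _ hc, ← Category.assoc, c.condition, Category.assoc, hs,
        Category.comp_id]
    · rw [← h₁, Category.assoc, htb, Category.comp_id]
  obtain ⟨i', hi', e⟩ := h.of_isPullback sq
  have : i' = f ≫ b.snd := by rw [← e, Category.assoc, htb, Category.comp_id]
  exact this ▸ hi'

end Exact

end ExactStructure

end IdealApprox

namespace IdealApprox

/-! ### Objects of ideals -/

namespace MorIdeal

variable {A : Type u} [Category.{v} A] [Preadditive A] {I : MorIdeal A}

lemma mem_of_factors {X Y Z : A} (s : X ⟶ Z) (t : Z ⟶ Y) (hZ : I.Ob Z) : I.toProp (s ≫ t) := by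
  have h := I.comp_mem s (𝟙 Z) t hZ
  rwa [Category.id_comp] at h

lemma toProp_comp {X Y Z : A} {f : X ⟶ Y} (hf : I.toProp f) (g : Y ⟶ Z) : I.toProp (f ≫ g) := by
  have h := I.comp_mem (𝟙 X) f g hf
  rwa [Category.id_comp] at h

lemma toProp_add {X Y : A} {f g : X ⟶ Y} (hf : I.toProp f) (hg : I.toProp g) :
    I.toProp (f + g) :=
  (I.hom X Y).add_mem hf hg

lemma exists_factors (hI : I.IsObjectIdeal) {X Y : A} {f : X ⟶ Y} (hf : I.toProp f) :
    ∃ (Z : A) (s : X ⟶ Z) (t : Z ⟶ Y), I.Ob Z ∧ s ≫ t = f := by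
  rw [hI] at hf
  exact hf

attribute [local instance] hasBinaryBiproducts_of_finite_biproducts in
lemma ob_biprod [HasFiniteBiproducts A] {X Y : A} (hX : I.Ob X) (hY : I.Ob Y) :
    I.Ob (X ⊞ Y) := by
  have h := toProp_add (mem_of_factors (biprod.fst : X ⊞ Y ⟶ X) biprod.inl hX)
    (mem_of_factors (biprod.snd : X ⊞ Y ⟶ Y) biprod.inr hY)
  rwa [biprod.total] at h

end MorIdeal

namespace ExactStructure

attribute [local instance] hasBinaryBiproducts_of_finite_biproducts

section Stable

variable {A : Type u} [Category.{v} A] [Preadditive A] [HasFiniteBiproducts A]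
  {E : ExactStructure A}

/-! ### The stable category -/

instance toStable_additive : E.toStable.Additive :=
  CategoryTheory.Quotient.functor_additive E.stableRel _

lemma toStable_map_eq_iff {X Y : A} (f g : X ⟶ Y) :
    E.toStable.map f = E.toStable.map g ↔ factorsThrough E.IsProjective (f - g) :=
  CategoryTheory.Quotient.functor_map_eq_iff E.stableRel f g

lemma toStable_map_eq_zero {X Y Z : A} (s : X ⟶ Z) (t : Z ⟶ Y) (hZ : E.IsProjective Z) :
    E.toStable.map (s ≫ t) = 0 := by
  rw [← E.toStable.map_zero, toStable_map_eq_iff]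
  exact ⟨Z, s, t, hZ, by simp⟩

lemma exists_toStable_map {X Y : A} (φ : E.toStable.obj X ⟶ E.toStable.obj Y) :
    ∃ f : X ⟶ Y, E.toStable.map f = φ := E.toStable.map_surjective φ

lemma isProjective_of_retract {X P : A} (hP : E.IsProjective P) {s : X ⟶ P} {t : P ⟶ X}
    (h : s ≫ t = 𝟙 X) : E.IsProjective X := fun B p hp => by
  obtain ⟨l, hl⟩ := hP.exists_lift hp t
  exact ⟨s ≫ l, by rw [Category.assoc, hl, h]⟩

lemma isProjective_of_toStable_id {X : A} (h : E.toStable.map (𝟙 X) = 0) : E.IsProjective X := by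
  rw [← E.toStable.map_zero, toStable_map_eq_iff, sub_zero] at h
  obtain ⟨P, s, t, hP, hst⟩ := h
  exact isProjective_of_retract hP hst

namespace IsFrobenius

lemma inj_isProjective (hE : E.IsFrobenius) (X : A) : E.IsProjective (hE.inj X) :=
  (hE.proj_iff_inj _).2 (hE.inj_isInjective X)

/-- A morphism with a stable retraction becomes a split monomorphism after adding an injective
hull to its target. -/
lemma exists_conf_of_stable_retraction (hE : E.IsFrobenius) {C D : A} {f : C ⟶ D} {g : D ⟶ C}
    (h : E.toStable.map (f ≫ g) = 𝟙 _) :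
    ∃ (Z : A) (w : hE.inj C ⊞ D ⟶ Z) (r : hE.inj C ⊞ D ⟶ C),
      E.Conf (biprod.lift (hE.ι C) f) w ∧ biprod.lift (hE.ι C) f ≫ r = 𝟙 C := by
  rw [← E.toStable.map_id, eq_comm, toStable_map_eq_iff] at h
  obtain ⟨P, s, t, hP, hst⟩ := h
  -- The error 1 − fg factors through P, which is also injective, so its first factor extends over
  -- the hull of C. The extension corrects `g` to a genuine retraction of (ι, f).
  obtain ⟨s', hs'⟩ := ((hE.proj_iff_inj P).1 hP).exists_extend ⟨_, _, hE.conf C⟩ s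
  have hi : E.Inflation (hE.ι C) := ⟨_, _, hE.conf C⟩
  obtain ⟨Z, w, hw⟩ := hi.biprod_lift f
  exact ⟨Z, w, biprod.desc (s' ≫ t) g, hw, by simp [reassoc_of% hs', hst]⟩

/-- A stable isomorphism becomes an inflation with projective cokernel after adding an injective
hull to its target. -/
lemma exists_conf_of_stable_iso (hE : E.IsFrobenius) {C D : A}
    (e : E.toStable.obj C ≅ E.toStable.obj D) :
    ∃ (f : C ⟶ D) (Z : A) (w : hE.inj C ⊞ D ⟶ Z),
      E.Conf (biprod.lift (hE.ι C) f) w ∧ E.IsProjective Z := by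
  obtain ⟨f, hf⟩ := exists_toStable_map e.hom
  obtain ⟨g, hg⟩ := exists_toStable_map e.inv
  obtain ⟨Z, w, r, hw, hr⟩ := hE.exists_conf_of_stable_retraction (f := f) (g := g)
    (by rw [Functor.map_comp, hf, hg, e.hom_inv_id])
  refine ⟨f, Z, w, hw, isProjective_of_toStable_id ?_⟩
  obtain ⟨s, hs, -, -⟩ := hw.exists_splitting hr
  -- Stably the hull vanishes and `f` is invertible, so the zero composite of the conflation forces
  -- `w` to be stably zero. Since `w` is a split epimorphism, 1_Z is stably zero as well.
  have h₁ : E.toStable.map (biprod.inr ≫ w : D ⟶ Z) = 0 := by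
    have : biprod.lift (hE.ι C) f ≫ w = hE.ι C ≫ biprod.inl ≫ w + f ≫ biprod.inr ≫ w := by
      rw [biprod.lift_eq, Preadditive.add_comp, Category.assoc, Category.assoc]
    have h₂ := congrArg E.toStable.map (this.symm.trans hw.zero)
    rw [E.toStable.map_add, toStable_map_eq_zero _ _ (hE.inj_isProjective C), zero_add,
      Functor.map_comp, hf, Functor.map_zero] at h₂
    rw [← cancel_epi e.hom, h₂, comp_zero]
  have h₂ : w = biprod.fst ≫ biprod.inl ≫ w + biprod.snd ≫ biprod.inr ≫ w := by
    ext <;> simp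
  have h₃ : E.toStable.map w = 0 := by
    rw [h₂, E.toStable.map_add, toStable_map_eq_zero _ _ (hE.inj_isProjective C),
      Functor.map_comp, h₁, comp_zero, zero_add]
  rw [← hs, Functor.map_comp, h₃, comp_zero]

end IsFrobenius

end Stable

/-! ### Ideal cotorsion pairs -/

section Cotorsion

variable {A : Type u} [Category.{v} A] [Preadditive A] [HasFiniteBiproducts A]
  {E : ExactStructure A}

/-- The pushout of the conflation along `g` splits; its retraction gives the extension. -/
lemma ExtZero.exists_extend {X Y M C : A} (h : E.ExtZero X Y) {f : M ⟶ C} {p : C ⟶ X}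
    (hf : E.Conf f p) (g : M ⟶ Y) : ∃ g' : C ⟶ Y, f ≫ g' = g := by
  obtain ⟨D, a, i, q, sq, hi, -⟩ := hf.exists_isPushout g
  obtain ⟨s, hs⟩ := h i q hi
  obtain ⟨r, hr⟩ := hi.exists_retraction hs
  exact ⟨a ≫ r, by rw [← Category.assoc, sq.w, Category.assoc, hr, Category.comp_id]⟩

lemma ExtZero.exists_lift {X Y C Z : A} (h : E.ExtZero X Y) {f : Y ⟶ C} {p : C ⟶ Z}
    (hf : E.Conf f p) (g : X ⟶ Z) : ∃ g' : X ⟶ C, g' ≫ p = g := by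
  obtain ⟨D, a, q, i, sq, hi, -⟩ := hf.exists_isPullback g
  obtain ⟨s, hs⟩ := h i q hi
  exact ⟨s ≫ a, by rw [Category.assoc, sq.w, ← Category.assoc, hs, Category.id_comp]⟩

/-- Every extension of X by Y maps to Y ↣ Q ↠ T, inducing some X ⟶ T at the right end. A lift of
that map to Q corrects C ⟶ Q so that it lands in Y, and this splits the extension. -/
lemma extZero_of_exists_lift {X Y Q T : A} {m : Y ⟶ Q} {q : Q ⟶ T} (hm : E.Conf m q)
    (hQ : E.IsInjective Q) (h : ∀ g : X ⟶ T, ∃ g' : X ⟶ Q, g' ≫ q = g) : E.ExtZero X Y := by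
  intro C i p hi
  obtain ⟨a, ha⟩ := hQ.exists_extend ⟨_, _, hi⟩ m
  obtain ⟨b, hb⟩ := hi.exists_desc (a ≫ q) (by rw [← Category.assoc, ha, hm.zero])
  obtain ⟨b', hb'⟩ := h b
  have := hm.mono
  obtain ⟨r, hr⟩ := hm.exists_lift (a - p ≫ b')
    (by rw [Preadditive.sub_comp, Category.assoc, hb', hb, sub_self])
  have hir : i ≫ r = 𝟙 Y := by
    rw [← cancel_mono m, Category.assoc, hr, Preadditive.comp_sub, ha, ← Category.assoc, hi.zero]
    simp
  obtain ⟨s, hs, -, -⟩ := hi.exists_splitting hir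
  exact ⟨s, hs⟩

/-- The left orthogonal of an object is closed under extensions. -/
lemma ExtZero.of_conf (hE : E.IsFrobenius) {X₁ X₂ W Y : A} (h₁ : E.ExtZero X₁ Y)
    (h₂ : E.ExtZero X₂ Y) {a : X₁ ⟶ W} {b : W ⟶ X₂} (h : E.Conf a b) : E.ExtZero W Y := by
  refine extZero_of_exists_lift (hE.conf Y) (hE.inj_isInjective Y) fun g => ?_
  obtain ⟨k, hk⟩ := h₁.exists_lift (hE.conf Y) (a ≫ g)
  -- Lift `g` on the subobject X₁, extend that lift to W by injectivity of the hull, then lift the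
  -- remainder, which factors through X₂.
  obtain ⟨k', hk'⟩ := (hE.inj_isInjective Y).exists_extend ⟨_, _, h⟩ k
  obtain ⟨l, hl⟩ := h.exists_desc (g - k' ≫ hE.π Y)
    (by rw [Preadditive.comp_sub, ← Category.assoc a, hk', hk, sub_self])
  obtain ⟨l', hl'⟩ := h₂.exists_lift (hE.conf Y) l
  exact ⟨k' + b ≫ l', by rw [Preadditive.add_comp, Category.assoc, hl', hl, add_sub_cancel]⟩

namespace IsCompleteIdealCotorsionPair

variable {I J : MorIdeal A} (hIJ : E.IsCompleteIdealCotorsionPair I J)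
include hIJ

lemma extZero {X Y : A} (hX : I.Ob X) (hY : J.Ob Y) : E.ExtZero X Y := by
  intro C i p h
  have hX' : E.leftPerp J.toProp (𝟙 X) := hIJ.left_eq ▸ hX
  exact hX' (𝟙 Y) hY i p i p i p (𝟙 C) (𝟙 C) h h h (by simp) (by simp) (by simp) (by simp)

lemma left_ob_of_isProjective {P : A} (hP : E.IsProjective P) : I.Ob P := by
  change I.toProp (𝟙 P)
  rw [hIJ.left_eq]
  intro B₀ B₁ m _ C C' C'' i p i' p' i'' p'' c c' _ _ h _ _ _ _
  exact hP p'' ⟨_, _, h⟩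

lemma right_ob_of_isInjective {Q : A} (hQ : E.IsInjective Q) : J.Ob Q := by
  change J.toProp (𝟙 Q)
  rw [hIJ.right_eq]
  intro B₀ B₁ m _ C C' C'' i p i' p' i'' p'' c c' _ _ h _ _ _ _
  obtain ⟨r, hr⟩ := hQ i'' ⟨_, _, h⟩
  obtain ⟨s, hs, -, -⟩ := h.exists_splitting hr
  exact ⟨s, hs⟩

/-- A morphism of 𝒥 factors through an object Z of Ob(𝒥), so a pushout along it passes through an
extension by Z, which splits. Hence orthogonality to objects already gives orthogonality to the
whole ideal. -/
lemma left_ob_iff (hJ : J.IsObjectIdeal) (X : A) :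
    I.Ob X ↔ ∀ Y : A, J.Ob Y → E.ExtZero X Y := by
  refine ⟨fun hX Y hY => hIJ.extZero hX hY, fun h => ?_⟩
  change I.toProp (𝟙 X)
  rw [hIJ.left_eq]
  intro B₀ B₁ m hm C C' C'' i p i' p' i'' p'' c c' hi hi' hi'' e₁ e₂ e₃ e₄
  obtain ⟨Z, s, t, hZ, rfl⟩ := MorIdeal.exists_factors hJ hm
  obtain ⟨a, ha⟩ := (h Z hZ).exists_extend hi s
  -- `c` and the detour `a ≫ t ≫ i'` agree on B₀; their difference descends to a section of `p'`.
  obtain ⟨b, hb⟩ := hi.exists_desc (c - a ≫ t ≫ i')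
    (by rw [Preadditive.comp_sub, e₁, reassoc_of% ha, Category.assoc, sub_self])
  have := hi.epi
  have hbp : b ≫ p' = 𝟙 X := by
    rw [← cancel_epi p, ← Category.assoc, hb, Preadditive.sub_comp, e₂]
    simp [hi'.zero]
  obtain ⟨r, hr⟩ := hi'.exists_retraction hbp
  obtain ⟨s', hs', -, -⟩ := hi''.exists_splitting (r := c' ≫ r) (by rw [reassoc_of% e₃, hr])
  exact ⟨s', hs'⟩

lemma right_ob_iff (hI : I.IsObjectIdeal) (Y : A) :
    J.Ob Y ↔ ∀ X : A, I.Ob X → E.ExtZero X Y := by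
  refine ⟨fun hY X hX => hIJ.extZero hX hY, fun h => ?_⟩
  change J.toProp (𝟙 Y)
  rw [hIJ.right_eq]
  intro A₀ A₁ m hm C C' C'' i p i' p' i'' p'' c c' hi hi' hi'' e₁ e₂ e₃ e₄
  obtain ⟨Z, s, t, hZ, rfl⟩ := MorIdeal.exists_factors hI hm
  obtain ⟨a, ha⟩ := (h Z hZ).exists_lift hi' t
  obtain ⟨r, hr⟩ := hi'.exists_lift (c' - p'' ≫ s ≫ a)
    (by simp only [Preadditive.sub_comp, Category.assoc, e₄, ha, sub_self])
  have := hi'.mono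
  have hir : i'' ≫ r = 𝟙 Y := by
    rw [← cancel_mono i', Category.assoc, hr, Preadditive.comp_sub, e₃, reassoc_of% hi''.zero]
    simp
  obtain ⟨s', hs', -, -⟩ := hi''.exists_splitting hir
  exact ⟨s', hs'⟩

lemma left_ob_of_conf (hE : E.IsFrobenius) (hJ : J.IsObjectIdeal) {X₁ X₂ W : A}
    (h₁ : I.Ob X₁) (h₂ : I.Ob X₂) {a : X₁ ⟶ W} {b : W ⟶ X₂} (h : E.Conf a b) : I.Ob W := by
  rw [hIJ.left_ob_iff hJ] at h₁ h₂ ⊢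
  exact fun Y hY => (h₁ Y hY).of_conf hE (h₂ Y hY) h

/-- The identity of X' is a map through X plus a map through a projective, and projectives lie in
Ob(ℐ). -/
lemma left_ob_of_stable_retract {X X' : A} (hX : I.Ob X) {s : X' ⟶ X} {t : X ⟶ X'}
    (h : E.toStable.map (s ≫ t) = 𝟙 _) : I.Ob X' := by
  rw [← E.toStable.map_id, eq_comm, toStable_map_eq_iff] at h
  obtain ⟨P, a, b, hP, hab⟩ := h
  have := MorIdeal.toProp_add (MorIdeal.mem_of_factors s t hX)
    (MorIdeal.mem_of_factors a b (hIJ.left_ob_of_isProjective hP))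
  rwa [hab, add_sub_cancel] at this

lemma right_ob_of_stable_retract (hE : E.IsFrobenius) {Y Y' : A} (hY : J.Ob Y) {s : Y' ⟶ Y}
    {t : Y ⟶ Y'} (h : E.toStable.map (s ≫ t) = 𝟙 _) : J.Ob Y' := by
  rw [← E.toStable.map_id, eq_comm, toStable_map_eq_iff] at h
  obtain ⟨P, a, b, hP, hab⟩ := h
  have := MorIdeal.toProp_add (MorIdeal.mem_of_factors s t hY)
    (MorIdeal.mem_of_factors a b (hIJ.right_ob_of_isInjective ((hE.proj_iff_inj P).1 hP)))
  rwa [hab, add_sub_cancel] at this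

lemma left_ob_of_stable_iso {X X' : A} (hX : I.Ob X)
    (e : E.toStable.obj X ≅ E.toStable.obj X') : I.Ob X' := by
  obtain ⟨s, hs⟩ := exists_toStable_map e.inv
  obtain ⟨t, ht⟩ := exists_toStable_map e.hom
  exact hIJ.left_ob_of_stable_retract hX (s := s) (t := t) (by simp [hs, ht])

lemma right_ob_of_stable_iso (hE : E.IsFrobenius) {Y Y' : A} (hY : J.Ob Y)
    (e : E.toStable.obj Y ≅ E.toStable.obj Y') : J.Ob Y' := by
  obtain ⟨s, hs⟩ := exists_toStable_map e.inv
  obtain ⟨t, ht⟩ := exists_toStable_map e.hom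
  exact hIJ.right_ob_of_stable_retract hE hY (s := s) (t := t) (by simp [hs, ht])

/-- If `ℐ` is an object ideal, then every object has a special `𝒥`-preenvelope whose cokernel
belongs to `Ob(ℐ)`. -/
lemma exists_conf_left_ob (hI : I.IsObjectIdeal) (M : A) :
    ∃ (C X : A) (f : M ⟶ C) (p : C ⟶ X), E.Conf f p ∧ J.toProp f ∧ I.Ob X := by
  obtain ⟨B, f, hf, K, B', L, k, q, l, g, h, hqk, hfl, sq, hfh, hg⟩ := hIJ.preenvelope M
  have hg' : I.toProp g := hIJ.left_eq ▸ hg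
  obtain ⟨X, s, t, hX, rfl⟩ := MorIdeal.exists_factors hI hg'
  obtain ⟨C, a, p, i, sq', hi, e⟩ := hqk.exists_isPullback t
  refine ⟨C, X, i, p, hi, ?_, hX⟩
  have hw : h ≫ k = (l ≫ s) ≫ t := by rw [sq.w, Category.assoc]
  -- The new inflation factors through the preenvelope, so it inherits membership in 𝒥.
  have : i = f ≫ sq'.lift h (l ≫ s) hw := sq'.hom_ext
    (by rw [Category.assoc, sq'.lift_fst, hfh, e])
    (by rw [Category.assoc, sq'.lift_snd, hi.zero, reassoc_of% hfl.zero, zero_comp])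
  rw [this]
  exact MorIdeal.toProp_comp hf.1 _

/-- In a conflation `M ↣ C ↠ X` with `X ∈ Ob(ℐ)` whose inflation belongs to `𝒥`, the object `C` is
a retract of the sum of `X` and an object of `Ob(𝒥)`. -/
lemma exists_id_eq (hJ : J.IsObjectIdeal) {M C X : A} {f : M ⟶ C} {p : C ⟶ X} (h : E.Conf f p)
    (hf : J.toProp f) (hX : I.Ob X) :
    ∃ (Y : A) (r : C ⟶ Y) (t : Y ⟶ C) (q : X ⟶ C), J.Ob Y ∧ r ≫ t + p ≫ q = 𝟙 C := by
  obtain ⟨Y, s, t, hY, rfl⟩ := MorIdeal.exists_factors hJ hf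
  obtain ⟨r, hr⟩ := (hIJ.extZero hX hY).exists_extend h s
  obtain ⟨q, hq⟩ := h.exists_desc (𝟙 C - r ≫ t)
    (by rw [Preadditive.comp_sub, ← Category.assoc, hr, Category.comp_id, sub_self])
  exact ⟨Y, r, t, q, hY, by rw [hq, add_sub_cancel]⟩

/-- Salce's trick: conflations `M ↣ Y ↠ X` for all `M` suffice for a complete cotorsion pair. -/
lemma isCompleteCotorsionPair_of_preenvelope (hE : E.IsFrobenius) (hI : I.IsObjectIdeal)
    (hJ : J.IsObjectIdeal)
    (h : ∀ M : A, ∃ (Y X : A) (i : M ⟶ Y) (p : Y ⟶ X), E.Conf i p ∧ I.Ob X ∧ J.Ob Y) :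
    E.IsCompleteCotorsionPair I.Ob J.Ob where
  left_eq := hIJ.left_ob_iff hJ
  right_eq := hIJ.right_ob_iff hI
  preenvelope := h
  precover M := by
    obtain ⟨P, p, hP, K, k, hk⟩ := hE.enough_proj M
    obtain ⟨Y, X, i, q, hi, hX, hY⟩ := h K
    -- The pushout of K ↣ P and K ↣ Y is an extension of M by Y and also of X by P; the latter puts
    -- it in Ob(ℐ).
    obtain ⟨W, a, b, w, sq, hb, -⟩ := hk.exists_isPushout i
    obtain ⟨w', hw', -⟩ := hi.of_isPushout sq.flip
    exact ⟨Y, W, b, w, hb, hIJ.left_ob_of_conf hE hJ (hIJ.left_ob_of_isProjective hP) hX hw', hY⟩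

/-- Enlarging the middle term of a conflation by a conflation with cokernel in `Ob(ℐ)`. -/
lemma exists_conf_comp (hE : E.IsFrobenius) (hJ : J.IsObjectIdeal) {M C X N X' : A}
    {f : M ⟶ C} {p : C ⟶ X} {j : C ⟶ N} {q : N ⟶ X'} (h : E.Conf f p) (h' : E.Conf j q)
    (hX : I.Ob X) (hX' : I.Ob X') : ∃ (W : A) (w : N ⟶ W), E.Conf (f ≫ j) w ∧ I.Ob W := by
  obtain ⟨W, w, a, b, hw, hab⟩ := h.comp h'
  exact ⟨W, w, hw, hIJ.left_ob_of_conf hE hJ hX hX' hab⟩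

end IsCompleteIdealCotorsionPair

end Cotorsion

end ExactStructure

end IdealApprox

namespace IdealApprox

attribute [local instance] hasBinaryBiproducts_of_finite_biproducts

/-! ### Rearranging biproducts -/

section Biproducts

variable {A : Type u} [Category.{v} A] [Preadditive A] [HasFiniteBiproducts A]

/-- Exchange of the first two summands of a sum of three objects. -/
noncomputable def biprodLeftComm (P Q R : A) : P ⊞ (Q ⊞ R) ≅ Q ⊞ (P ⊞ R) where
  hom := biprod.lift (biprod.snd ≫ biprod.fst) (biprod.map (𝟙 P) biprod.snd)
  inv := biprod.lift (biprod.snd ≫ biprod.fst) (biprod.map (𝟙 Q) biprod.snd)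
  hom_inv_id := by ext <;> simp
  inv_hom_id := by ext <;> simp

/-- Splitting off the first summand of a finite sum. -/
noncomputable def biproductSuccBiprod {n : ℕ} (F : Fin (n + 1) → A) (Y : A) :
    (⨁ F) ⊞ Y ≅ F 0 ⊞ ((⨁ fun j => F (Fin.succ j)) ⊞ Y) where
  hom := biprod.lift (biprod.fst ≫ biproduct.π F 0)
    (biprod.map (biproduct.lift fun j => biproduct.π F (Fin.succ j)) (𝟙 Y))
  inv := biprod.desc (biproduct.ι F 0 ≫ biprod.inl)
    (biprod.map (biproduct.desc fun j => biproduct.ι F (Fin.succ j)) (𝟙 Y))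
  hom_inv_id := by
    have h : biproduct.π F 0 ≫ biproduct.ι F 0 +
        (biproduct.lift fun j : Fin n => biproduct.π F (Fin.succ j)) ≫
          (biproduct.desc fun j : Fin n => biproduct.ι F (Fin.succ j)) = 𝟙 (⨁ F) := by
      rw [biproduct.lift_desc, ← Fin.sum_univ_succ (fun j => biproduct.π F j ≫ biproduct.ι F j),
        biproduct.total]
    apply biprod.hom_ext' <;> apply biprod.hom_ext
    · simpa using h
    all_goals simp
  inv_hom_id := by
    have h₁ : (biproduct.desc fun j : Fin n => biproduct.ι F (Fin.succ j)) ≫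
        biproduct.π F 0 = 0 := by
      ext j
      simp [biproduct.ι_π_ne F (Fin.succ_ne_zero j)]
    have h₂ : biproduct.ι F 0 ≫
        (biproduct.lift fun j : Fin n => biproduct.π F (Fin.succ j)) = 0 := by
      ext j
      simp [biproduct.ι_π_ne F (Fin.succ_ne_zero j).symm]
    have h₃ : (biproduct.desc fun j : Fin n => biproduct.ι F (Fin.succ j)) ≫
        (biproduct.lift fun j : Fin n => biproduct.π F (Fin.succ j)) = 𝟙 _ := by
      ext j k
      by_cases hjk : k = j
      · subst hjk
        simp
      · have : Fin.succ k ≠ Fin.succ j := fun h => hjk (Fin.succ_injective _ h)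
        simp [biproduct.ι_π_ne _ hjk, biproduct.ι_π_ne F this]
    apply biprod.hom_ext' <;> apply biprod.hom_ext
    · simp
    · apply biprod.hom_ext
      · simpa using h₂
      · simp
    · apply biprod.hom_ext'
      · simpa using h₁
      · simp
    · simp only [biprod.inr_desc_assoc, biprod.lift_snd, Category.assoc,
        Category.comp_id, biprod.inr_snd]
      apply biprod.hom_ext' <;> apply biprod.hom_ext
      · simpa using h₃
      all_goals simp

end Biproducts

namespace ExactStructure

variable {A : Type u} [Category.{v} A] [Preadditive A] [HasFiniteBiproducts A]
  {E : ExactStructure A}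

lemma Conf.of_middle_iso {X Y Y' Z : A} {i : X ⟶ Y} {p : Y ⟶ Z} (h : E.Conf i p)
    (e : Y ≅ Y') : E.Conf (i ≫ e.hom) (e.inv ≫ p) :=
  h.of_iso (Iso.refl _) e (Iso.refl _) (by simp) (by simp)

namespace IsCompleteIdealCotorsionPair

variable {I J : MorIdeal A} (hIJ : E.IsCompleteIdealCotorsionPair I J)
include hIJ

/-! ### From direct summands to complete cotorsion pairs -/

/-- Every object has a `𝒥`-preenvelope with target in `smd(𝒳 ⊕ 𝒴)` and cokernel in `𝒳`. -/
lemma exists_conf_smd_sumProp (hE : E.IsFrobenius) (hI : I.IsObjectIdeal) (hJ : J.IsObjectIdeal)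
    (M : A) : ∃ (C X : A) (f : M ⟶ C) (p : C ⟶ X),
      E.Conf f p ∧ smd (sumProp I.Ob J.Ob) C ∧ I.Ob X := by
  obtain ⟨C, X, f, p, h, hf, hX⟩ := hIJ.exists_conf_left_ob hI M
  refine ⟨C, X, f, p, h, ?_, hX⟩
  obtain ⟨Y, r, t, q, hY, e⟩ := hIJ.exists_id_eq hJ h hf hX
  -- C is already a retract of X ⊕ Y. Adding the hull of C makes the section an inflation, whose
  -- cokernel W is the required complement.
  obtain ⟨W, w, ρ, hw, hρ⟩ := hE.exists_conf_of_stable_retraction (f := biprod.lift p r)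
    (g := biprod.desc q t) (by rw [biprod.lift_desc, add_comm, e, CategoryTheory.Functor.map_id])
  obtain ⟨s, hs, hsr, ht⟩ := hw.exists_splitting hρ
  let b : BinaryBicone C W :=
    { pt := hE.inj C ⊞ (X ⊞ Y)
      fst := ρ
      snd := w
      inl := biprod.lift (hE.ι C) (biprod.lift p r)
      inr := s
      inl_fst := hρ
      inl_snd := hw.zero
      inr_fst := hsr
      inr_snd := hs }
  exact ⟨b.pt, W, b, ⟨X, hE.inj C ⊞ Y, BinaryBiproduct.bicone _ _, hX,
    MorIdeal.ob_biprod (hIJ.right_ob_of_isInjective (hE.inj_isInjective C)) hY,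
    ⟨BinaryBiproduct.isBilimit _ _⟩, ⟨biprodLeftComm _ _ _⟩⟩,
    ⟨isBinaryBilimitOfTotal b ht⟩, ⟨Iso.refl _⟩⟩

lemma isCompleteCotorsionPair_of_smd (hE : E.IsFrobenius) (hI : I.IsObjectIdeal)
    (hJ : J.IsObjectIdeal)
    (h : ∀ M : A, smd (sumProp I.Ob J.Ob) M →
      ∃ (Y X : A) (i : M ⟶ Y) (p : Y ⟶ X), J.Ob Y ∧ I.Ob X ∧ E.Conf i p) :
    E.IsCompleteCotorsionPair I.Ob J.Ob := by
  refine hIJ.isCompleteCotorsionPair_of_preenvelope hE hI hJ fun M => ?_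
  obtain ⟨C, X, f, p, hf, hC, hX⟩ := hIJ.exists_conf_smd_sumProp hE hI hJ M
  obtain ⟨Y, X', j, q, hY, hX', hj⟩ := h C hC
  obtain ⟨W, w, hw, hW⟩ := hIJ.exists_conf_comp hE hJ hf hj hX hX'
  exact ⟨Y, W, f ≫ j, w, hw, hW, hY⟩

/-! ### Conflations and triangles -/

/-- The cone C of `i` is the pushout of M ↣ Y and M ↣ I(M), so it is an extension of X by I(M).
Taking C as third term avoids comparing it with X. -/
lemma exists_triangle (hE : E.IsFrobenius) (hJ : J.IsObjectIdeal) {M Y X : A} {i : M ⟶ Y}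
    {p : Y ⟶ X} (h : E.Conf i p) (hX : I.Ob X) :
    ∃ (C : A) (g : E.toStable.obj Y ⟶ E.toStable.obj C)
      (k : E.toStable.obj C ⟶ hE.shift.obj (E.toStable.obj M)),
      I.Ob C ∧ hE.IsTriangle (E.toStable.map i) g k := by
  obtain ⟨C, a, b, w, sq, hb, e⟩ := (hE.conf M).exists_isPushout i
  obtain ⟨p', hp', -⟩ := h.of_isPushout sq.flip
  refine ⟨C, E.toStable.map b, E.toStable.map w,
    hIJ.left_ob_of_conf hE hJ (hIJ.left_ob_of_isProjective (hE.inj_isProjective M)) hX hp',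
    M, Y, C, i, a, b, w, sq, e, hb, Iso.refl _, Iso.refl _, Iso.refl _, ?_, ?_, ?_⟩
  · simp
  · simp
  · exact (congrArg (E.toStable.map w ≫ ·) (hE.shift.map_id _)).trans
      ((Category.comp_id _).trans (Category.id_comp _).symm)

lemma exists_conf_of_isTriangle (hE : E.IsFrobenius) (hJ : J.IsObjectIdeal) {M Y X : A}
    {u : E.toStable.obj M ⟶ E.toStable.obj Y} {v : E.toStable.obj Y ⟶ E.toStable.obj X}
    {w : E.toStable.obj X ⟶ hE.shift.obj (E.toStable.obj M)} (h : hE.IsTriangle u v w)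
    (hY : J.Ob Y) (hX : I.Ob X) :
    ∃ (Y' X' : A) (i : M ⟶ Y') (p : Y' ⟶ X'), J.Ob Y' ∧ I.Ob X' ∧ E.Conf i p := by
  obtain ⟨M', N, C, f, i, v', w', sq, -, -, a, b, c, -, -, -⟩ := h
  have hN : J.Ob N := hIJ.right_ob_of_stable_iso hE hY b
  have hC : I.Ob C := hIJ.left_ob_of_stable_iso hX c
  -- The pushout gives M' ↣ I(M') ⊕ N ↠ C, starting at M' instead of M. The stable isomorphism gives
  -- M ↣ M' ⊕ I(M) with projective cokernel; compose it with the former plus 1 on I(M).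
  have h₁ := Inflation.conf_of_isPushout (E := E) ⟨_, _, hE.conf M'⟩ sq
  obtain ⟨f', Z, z, hz, hZ⟩ := hE.exists_conf_of_stable_iso a
  have hz' := hz.of_middle_iso (biprod.braiding _ _)
  obtain ⟨q, hq⟩ := h₁.biprod_map_id (hE.inj M)
  obtain ⟨W, w₁, hw₁, hW⟩ :=
    hIJ.exists_conf_comp hE hJ hz' hq (hIJ.left_ob_of_isProjective hZ) hC
  exact ⟨_, W, _, w₁, MorIdeal.ob_biprod (MorIdeal.ob_biprod
    (hIJ.right_ob_of_isInjective (hE.inj_isInjective _)) hN)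
    (hIJ.right_ob_of_isInjective (hE.inj_isInjective _)), hW, hw₁⟩

/-! ### The Krull-Schmidt case -/

/-- In a conflation `M ↣ L ⊕ T ↠ X` with `X ∈ Ob(ℐ)` whose inflation belongs to `𝒥`, a summand `L`
with local stable endomorphism ring belongs to `Ob(𝒥)` or can be replaced by an injective. -/
lemma ob_or_exists_conf_inj_biprod (hE : E.IsFrobenius) (hJ : J.IsObjectIdeal) {L T M X : A}
    (hL : IsLocalRing (End (E.toStable.obj L))) {f : M ⟶ L ⊞ T} {p : L ⊞ T ⟶ X}
    (h : E.Conf f p) (hf : J.toProp f) (hX : I.Ob X) :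
    J.Ob L ∨ ∃ (W : A) (f' : M ⟶ hE.inj L ⊞ T) (p' : hE.inj L ⊞ T ⟶ W),
      E.Conf f' p' ∧ J.toProp f' ∧ I.Ob W := by
  obtain ⟨Y, r, t, q, hY, e⟩ := hIJ.exists_id_eq hJ h hf hX
  let α : End (E.toStable.obj L) := E.toStable.map (biprod.inl ≫ r ≫ t ≫ biprod.fst)
  let β : End (E.toStable.obj L) := E.toStable.map (biprod.inl ≫ p ≫ q ≫ biprod.fst)
  have hαβ : α + β = 1 := by
    have : (biprod.inl ≫ (r ≫ t + p ≫ q) ≫ biprod.fst : L ⟶ L) = 𝟙 L := by rw [e]; simp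
    change E.toStable.map _ + E.toStable.map _ = 𝟙 _
    rw [← E.toStable.map_add, ← E.toStable.map_id, ← this]
    simp
  rcases hL.isUnit_or_isUnit_of_add_one hαβ with hu | hu
  · left
    have : IsIso (E.toStable.map (biprod.inl ≫ r ≫ t ≫ biprod.fst : L ⟶ L)) :=
      (isUnit_iff_isIso α).1 hu
    obtain ⟨k, hk⟩ := exists_toStable_map
      (inv (E.toStable.map (biprod.inl ≫ r ≫ t ≫ biprod.fst : L ⟶ L)))
    refine hIJ.right_ob_of_stable_retract hE hY (s := biprod.inl ≫ r)
      (t := t ≫ biprod.fst ≫ k) ?_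
    have := IsIso.hom_inv_id (E.toStable.map (biprod.inl ≫ r ≫ t ≫ biprod.fst : L ⟶ L))
    rw [← hk, ← Functor.map_comp] at this
    simpa only [Category.assoc] using this
  · right
    have : IsIso (E.toStable.map (biprod.inl ≫ p ≫ q ≫ biprod.fst : L ⟶ L)) :=
      (isUnit_iff_isIso β).1 hu
    obtain ⟨k, hk⟩ := exists_toStable_map
      (inv (E.toStable.map (biprod.inl ≫ p ≫ q ≫ biprod.fst : L ⟶ L)))
    have := IsIso.hom_inv_id (E.toStable.map (biprod.inl ≫ p ≫ q ≫ biprod.fst : L ⟶ L))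
    rw [← hk, ← Functor.map_comp] at this
    obtain ⟨W, w, ρ, hw, hρ⟩ := hE.exists_conf_of_stable_retraction (f := biprod.inl ≫ p)
      (g := q ≫ biprod.fst ≫ k) (by simpa only [Category.assoc] using this)
    -- L is embedded by the graph of `hE.ι L`, not as a coordinate summand, so that its image in
    -- I(L) ⊕ X is exactly the split inflation found above and `Conf.cancel` applies.
    let b : BinaryBicone L (hE.inj L ⊞ T) :=
      { pt := hE.inj L ⊞ (L ⊞ T)
        fst := biprod.snd ≫ biprod.fst
        snd := biprod.lift (biprod.fst - biprod.snd ≫ biprod.fst ≫ hE.ι L)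
          (biprod.snd ≫ biprod.snd)
        inl := biprod.lift (hE.ι L) biprod.inl
        inr := biprod.map (𝟙 _) biprod.inr
        inl_fst := by simp
        inl_snd := by ext <;> simp
        inr_fst := by simp
        inr_snd := by ext <;> simp }
    have hb : b.fst ≫ b.inl + b.snd ≫ b.inr = 𝟙 b.pt := by
      dsimp only [b]
      ext <;> simp
    have hbp : b.inl ≫ biprod.map (𝟙 _) p = biprod.lift (hE.ι L) (biprod.inl ≫ p) := by
      dsimp only [b]
      ext <;> simp
    obtain ⟨s, hs, -, -⟩ := hw.exists_splitting hρ
    refine ⟨W, _, _, Conf.cancel b hb (h.id_biprod_map (hE.inj L)) (w := w) (r := ρ)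
      (by rw [hbp]; exact hw) (by rw [hbp]; exact hρ), ?_, ?_⟩
    · exact MorIdeal.toProp_comp (MorIdeal.toProp_comp hf _) _
    -- W is a retract of I(L) ⊕ X.
    · have := MorIdeal.mem_of_factors s w (MorIdeal.ob_biprod
        (hIJ.left_ob_of_isProjective (hE.inj_isProjective L)) hX)
      rwa [hs] at this

/-- Y accumulates the treated summands: at each step F 0 joins it, either itself or replaced by its
injective hull. -/
lemma exists_conf_of_local (hE : E.IsFrobenius) (hJ : J.IsObjectIdeal) (n : ℕ) :
    ∀ (F : Fin n → A) (_ : ∀ j, IsLocalRing (End (E.toStable.obj (F j)))) {M Y X : A}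
      {f : M ⟶ (⨁ F) ⊞ Y} {p : (⨁ F) ⊞ Y ⟶ X} (_ : E.Conf f p) (_ : J.toProp f)
      (_ : I.Ob X) (_ : J.Ob Y),
      ∃ (Y' X' : A) (i : M ⟶ Y') (p' : Y' ⟶ X'), E.Conf i p' ∧ I.Ob X' ∧ J.Ob Y' := by
  induction n with
  | zero =>
    intro F _ M Y X f p h _ hX hY
    refine ⟨_, X, f, p, h, hX, MorIdeal.ob_biprod ?_ hY⟩
    have : 𝟙 (⨁ F) = 0 := by
      ext j
      exact j.elim0
    change 𝟙 (⨁ F) ∈ J.hom _ _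
    rw [this]
    exact zero_mem _
  | succ n ih =>
    intro F hF M Y X f p h hf hX hY
    have h₁ := h.of_middle_iso (biproductSuccBiprod F Y)
    have hf₁ := MorIdeal.toProp_comp hf (biproductSuccBiprod F Y).hom
    rcases hIJ.ob_or_exists_conf_inj_biprod hE hJ (hF 0) h₁ hf₁ hX with hL | ⟨W, f', p', h', hf', hW⟩
    · exact ih _ (fun j => hF (Fin.succ j)) (h₁.of_middle_iso (biprodLeftComm _ _ _))
        (MorIdeal.toProp_comp hf₁ _) hX (MorIdeal.ob_biprod hL hY)
    · exact ih _ (fun j => hF (Fin.succ j)) (h'.of_middle_iso (biprodLeftComm _ _ _))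
        (MorIdeal.toProp_comp hf' _) hW (MorIdeal.ob_biprod
          (hIJ.right_ob_of_isInjective (hE.inj_isInjective _)) hY)

lemma isCompleteCotorsionPair_of_isKrullSchmidt (hE : E.IsFrobenius) (hI : I.IsObjectIdeal)
    (hJ : J.IsObjectIdeal) (hKS : IsKrullSchmidt E.Stable) :
    E.IsCompleteCotorsionPair I.Ob J.Ob := by
  refine hIJ.isCompleteCotorsionPair_of_preenvelope hE hI hJ fun M => ?_
  obtain ⟨C, X, f, p, h, hf, hX⟩ := hIJ.exists_conf_left_ob hI M
  obtain ⟨n, F, b, ⟨hb⟩, ⟨e⟩, hF⟩ := hKS (E.toStable.obj C)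
  let F' : Fin n → A := fun j => (F j).as
  let b' : Limits.Bicone F := E.toStable.mapBicone (biproduct.bicone F')
  have hb' : b'.IsBilimit := isBilimitOfPreserves E.toStable (biproduct.isBilimit F')
  have : HasBiproduct F := ⟨⟨⟨b, hb⟩⟩⟩
  have e' : E.toStable.obj C ≅ E.toStable.obj (⨁ F') :=
    e ≪≫ biproduct.uniqueUpToIso F hb ≪≫ (biproduct.uniqueUpToIso F hb').symm
  -- The decomposition of C is only stable; C embeds in the actual sum plus I(C), with projective
  -- cokernel, and I(C) is the initial Y of the induction.
  obtain ⟨g, Z, z, hz, hZ⟩ := hE.exists_conf_of_stable_iso e'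
  obtain ⟨W, w, hw, hW⟩ := hIJ.exists_conf_comp hE hJ h hz hX (hIJ.left_ob_of_isProjective hZ)
  exact hIJ.exists_conf_of_local hE hJ n F' hF (hw.of_middle_iso (biprod.braiding _ _))
    (MorIdeal.toProp_comp (MorIdeal.toProp_comp hf _) _) hW
    (hIJ.right_ob_of_isInjective (hE.inj_isInjective C))

end IsCompleteIdealCotorsionPair

lemma smd_sumProp_toStable {P Q : ObjectProperty A} {M : A} (h : smd (sumProp P Q) M) :
    smd (sumProp (P.strictMap E.toStable) (Q.strictMap E.toStable)) (E.toStable.obj M) := by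
  obtain ⟨Z, N, b, ⟨X, Y, b', hX, hY, ⟨hb'⟩, ⟨e'⟩⟩, ⟨hb⟩, ⟨e⟩⟩ := h
  have := preservesBinaryBiproducts_of_preservesBiproducts E.toStable
  exact ⟨E.toStable.obj Z, E.toStable.obj N, E.toStable.mapBinaryBicone b,
    ⟨E.toStable.obj X, E.toStable.obj Y, E.toStable.mapBinaryBicone b', ⟨X, hX⟩, ⟨Y, hY⟩,
      ⟨isBinaryBilimitOfPreserves E.toStable hb'⟩, ⟨E.toStable.mapIso e'⟩⟩,
    ⟨isBinaryBilimitOfPreserves E.toStable hb⟩, ⟨E.toStable.mapIso e⟩⟩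

end ExactStructure

end IdealApprox

/-! ### The equivalence and the Krull–Schmidt case -/

theorem corollary1p3 {A : Type u} [Category.{v} A] [Preadditive A] [HasFiniteBiproducts A]
    (E : IdealApprox.ExactStructure A) (hE : E.IsFrobenius)
    (I J : IdealApprox.MorIdeal A) (hIJ : E.IsCompleteIdealCotorsionPair I J)
    (hI : I.IsObjectIdeal) (hJ : J.IsObjectIdeal) :
    [ E.IsCompleteCotorsionPair I.Ob J.Ob,
      ∀ M : E.Stable,
        IdealApprox.smd (IdealApprox.sumProp (I.Ob.strictMap E.toStable)
          (J.Ob.strictMap E.toStable)) M →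
        ∃ (Y X : A) (f : M ⟶ E.toStable.obj Y) (g : E.toStable.obj Y ⟶ E.toStable.obj X)
          (h : E.toStable.obj X ⟶ hE.shift.obj M),
          J.Ob Y ∧ I.Ob X ∧ hE.IsTriangle f g h,
      ∀ M : A,
        IdealApprox.smd (IdealApprox.sumProp I.Ob J.Ob) M →
        ∃ (Y X : A) (i : M ⟶ Y) (p : Y ⟶ X), J.Ob Y ∧ I.Ob X ∧ E.Conf i p ].TFAE ∧
    (IdealApprox.IsKrullSchmidt E.Stable →
      E.IsCompleteCotorsionPair I.Ob J.Ob ∧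
      (∀ M : E.Stable,
        IdealApprox.smd (IdealApprox.sumProp (I.Ob.strictMap E.toStable)
          (J.Ob.strictMap E.toStable)) M →
        ∃ (Y X : A) (f : M ⟶ E.toStable.obj Y) (g : E.toStable.obj Y ⟶ E.toStable.obj X)
          (h : E.toStable.obj X ⟶ hE.shift.obj M),
          J.Ob Y ∧ I.Ob X ∧ hE.IsTriangle f g h) ∧
      (∀ M : A,
        IdealApprox.smd (IdealApprox.sumProp I.Ob J.Ob) M →
        ∃ (Y X : A) (i : M ⟶ Y) (p : Y ⟶ X), J.Ob Y ∧ I.Ob X ∧ E.Conf i p)) := by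

  have h12 : E.IsCompleteCotorsionPair I.Ob J.Ob → ∀ M : E.Stable,
      ∃ (Y X : A) (f : M ⟶ E.toStable.obj Y) (g : E.toStable.obj Y ⟶ E.toStable.obj X)
        (h : E.toStable.obj X ⟶ hE.shift.obj M), J.Ob Y ∧ I.Ob X ∧ hE.IsTriangle f g h := by
    intro h M
    obtain ⟨Y, X, i, p, hip, hX, hY⟩ := h.preenvelope M.as
    obtain ⟨C, g, k, hC, hT⟩ := hIJ.exists_triangle hE hJ hip hX
    exact ⟨Y, C, E.toStable.map i, g, k, hY, hC, hT⟩
  have h13 : E.IsCompleteCotorsionPair I.Ob J.Ob → ∀ M : A,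
      ∃ (Y X : A) (i : M ⟶ Y) (p : Y ⟶ X), J.Ob Y ∧ I.Ob X ∧ E.Conf i p := by
    intro h M
    obtain ⟨Y, X, i, p, hip, hX, hY⟩ := h.preenvelope M
    exact ⟨Y, X, i, p, hY, hX, hip⟩
  constructor
  · tfae_have 1 → 2 := fun h M _ => h12 h M
    tfae_have 2 → 3 := by
      intro h M hM
      obtain ⟨Y, X, f, g, k, hY, hX, hT⟩ :=
        h _ (IdealApprox.ExactStructure.smd_sumProp_toStable hM)
      exact hIJ.exists_conf_of_isTriangle hE hJ hT hY hX
    tfae_have 3 → 1 := hIJ.isCompleteCotorsionPair_of_smd hE hI hJ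
    tfae_finish
  · intro hKS
    have h := hIJ.isCompleteCotorsionPair_of_isKrullSchmidt hE hI hJ hKS
    exact ⟨h, fun M _ => h12 h M, fun M _ => h13 h M⟩
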